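/- **Language.** A signature $\mathcal S$ consists of an infinite set $\mathcal C$ of individual constants and a set $\mathcal P$ of predicate letters of finite arity (of any cardinalities), with a binary letter $\approx$ (identity) in $\mathcal P$. Formulas are built from atoms $P(t_1,\dots,t_n)$, where each $t_i$ is a constant or one of the variables $v_0,v_1,\dots$, by $\neg,\land,\lor,\forall x,\exists x$, and void quantifiers are not allowed ($x$ must be free in $A$ in $\forall xA$ and $\exists xA$). A sentence is a formula without free variables; $A(c/x)$ is the result of replacing every free occurrence of $x$ in $A$ by $c$. **Deductive systems.** $QFDE$ is the natural deduction system on sentences with the following rules; bracketed hypotheses are discharged. - $\land I$: $A,B/A\land B$; $\land E$: $A\land B/A$ and $A\land B/B$. - $\lor I$: $A/A\lor B$ and $B/A\lor B$; $\lor E$: from $A\lor B$, a derivation of $C$ from $[A]$ and one of $C$ from $[B]$, infer $C$. - $\neg\land I$: $\neg A/\neg(A\land B)$ and $\neg B/\neg(A\land B)$; $\neg\land E$: from $\neg(A\land B)$, a derivation of $C$ from $[\neg A]$ and one of $C$ from $[\neg B]$, infer $C$. - $\neg\lor I$: $\neg A,\neg B/\neg(A\lor B)$; $\neg\lor E$: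 $\neg(A\lor B)/\neg A$ and $\neg(A\lor B)/\neg B$. - $DN$: $A/\neg\neg A$ and $\neg\neg A/A$. - $\forall I$: $B\lor A(c/x)/B\lor\forall xA$; $\forall E$: $\forall xA/A(c/x)$. - $\exists I$: $A(c/x)/\exists xA$; $\exists E$: from $\exists xA$ and a derivation of $C$ from $[A(c/x)]$, infer $C$. - $\neg\forall I$: $\neg A(c/x)/\neg\forall xA$; $\neg\forall E$: from $\neg\forall xA$ and a derivation of $C$ from $[\neg A(c/x)]$, infer $C$. - $\neg\exists I$: $\neg A(c/x)/\neg\exists xA$; $\neg\exists E$: $\neg\exists xA/\neg A(c/x)$. - $\approx I$: $c\approx c$ (no premises); $\approx E$: $c_1\approx c_2,\ A(c_1/x)/A(c_2/x)$. In $\forall I$, $c$ must not occur in $A$, in $B$, or in any hypothesis on which $B\lor A(c/x)$ depends; in $\neg\exists I$, $c$ must not occur in $A$ or in any hypothesis on which $\neg A(c/x)$ depends; in $\exists E$ and $\neg\forall E$, $c$ must not occur in $A$, in $C$, or in any hypothesis on which the minor premise $C$ depends other than the discharged one. $QLP$ is $QFDE$ plus the rule $PEM$ (infer $A\lor\neg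 A$ from no premises); $QK3$ is $QFDE$ plus the rule $EXP$ (from $A$ and $\neg A$ infer any $B$); $QCL$ is $QFDE$ plus both. For a set $\Gamma$ of sentences, $\Gamma\vdash_{\mathcal L}A$ means that there is a derivation of $A$ in $\mathcal L$ whose undischarged hypotheses all belong to $\Gamma$. **Semantics.** An $\mathcal S$-structure $\mathfrak A$ consists of a non-empty domain $\mathcal D$, an element $c^{\mathfrak A}\in\mathcal D$ for each $c\in\mathcal C$, and, for each $n$-ary $P\in\mathcal P$, an extension $P_+^{\mathfrak A}\subseteq\mathcal D^n$ and an anti-extension $P_-^{\mathfrak A}\subseteq\mathcal D^n$, where $\approx_+^{\mathfrak A}=\{\langle a,a\rangle:a\in\mathcal D\}$. The diagram language adds a new constant $\bar a$ denoting $a$ for each $a\in\mathcal D$. The valuation $v_{\mathfrak A}$ induced by $\mathfrak A$ is the unique map from the sentences of the diagram language to $\{0,1\}$ such that, for all $c_1,\dots,c_n$ in the diagram language, denoting $d_1,\dots,d_n$, all predicate letters $P$, and all $A$, $B$, $x$ for which the expressions below are sentences: - $v(P(c_1,\dots,c_n))=1$ iff $\langle d_1,\dots,d_n\rangle\in P_+^{\mathfrak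 A}$, and $v(\neg P(c_1,\dots,c_n))=1$ iff $\langle d_1,\dots,d_n\rangle\in P_-^{\mathfrak A}$; - $v(A\land B)=1$ iff $v(A)=1$ and $v(B)=1$; $v(A\lor B)=1$ iff $v(A)=1$ or $v(B)=1$; - $v(\neg(A\land B))=1$ iff $v(\neg A)=1$ or $v(\neg B)=1$; $v(\neg(A\lor B))=1$ iff $v(\neg A)=1$ and $v(\neg B)=1$; $v(\neg\neg A)=1$ iff $v(A)=1$; - $v(\forall xA)=1$ iff $v(A(\bar a/x))=1$ for every $a\in\mathcal D$; $v(\exists xA)=1$ iff $v(A(\bar a/x))=1$ for some $a\in\mathcal D$; - $v(\neg\forall xA)=1$ iff $v(\neg A(\bar a/x))=1$ for some $a\in\mathcal D$; $v(\neg\exists xA)=1$ iff $v(\neg A(\bar a/x))=1$ for every $a\in\mathcal D$. A sentence $A$ of $\mathcal S$ holds in $\mathfrak A$ if $v_{\mathfrak A}(A)=1$. The structure $\mathfrak A$ is a $QLP$-structure if $P_+^{\mathfrak A}\cup P_-^{\mathfrak A}=\mathcal D^n$ for every $n$-ary $P\in\mathcal P$ (including $\approx$); a $QK3$-structure if $P_+^{\mathfrak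 A}\cap P_-^{\mathfrak A}=\emptyset$ for every $P\in\mathcal P$ (including $\approx$); a $QCL$-structure if both conditions hold. $\Gamma\vDash_{\mathcal L}A$ means that $A$ holds in every $\mathcal L$-structure in which all members of $\Gamma$ hold. **Theorem.** Let $\mathcal L$ be one of $QLP$, $QK3$, $QCL$. For every signature $\mathcal S$, every set $\Gamma$ of sentences of $\mathcal S$ and every sentence $A$ of $\mathcal S$, $$\Gamma\vdash_{\mathcal L}A\quad\Longleftrightarrow\quad\Gamma\vDash_{\mathcal L}A .$$ -/

import Mathlib

universe u v w

namespace QFDE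

/-! ### Signatures, terms, formulas, sentences -/

/-- Predicate letters of each arity: the letters in `R` together with the binary letter `≈`. -/
inductive Pred (R : ℕ → Type v) : ℕ → Type v
  | rel {n : ℕ} (P : R n) : Pred R n
  | eq : Pred R 2

set_option linter.checkUnivs false in
/-- A first-order signature: an infinite set of individual constants, and predicate letters.
`Rel n` is the set of `n`-ary predicate letters other than the identity symbol; the identity
symbol is added in `Pred`. -/
structure Signature where
  Const : Type u
  Rel : ℕ → Type v
  infinite_const : Infinite Const

/-- All `n`-ary predicate letters of the signature, the identity symbol included. -/
abbrev Signature.Pred (S : Signature.{u, v}) (n : ℕ) : Type v := QFDE.Pred S.Rel n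

/-- Terms are individual variables `v_i` (`i : ℕ`) and individual constants. -/
inductive Term (S : Signature.{u, v}) : Type u
  | var (x : ℕ) : Term S
  | const (c : S.Const) : Term S

/-- Raw formulas, in which void quantifiers may occur; see `Formula.NonVoid`. -/
inductive Formula (S : Signature.{u, v}) : Type (max u v)
  | pred {n : ℕ} (P : S.Pred n) (ts : Fin n → Term S) : Formula S
  | neg (A : Formula S) : Formula S
  | and (A B : Formula S) : Formula S
  | or (A B : Formula S) : Formula S
  | all (x : ℕ) (A : Formula S) : Formula S
  | ex (x : ℕ) (A : Formula S) : Formula S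

variable {S : Signature.{u, v}}

/-- Replace the variable `x` by the constant `c` in a term. -/
def Term.subst (x : ℕ) (c : S.Const) : Term S → Term S
  | .var y => if y = x then .const c else .var y
  | .const d => .const d

namespace Formula

/-- The identity statement `c ≈ d` between two constants. -/
def eqn (c d : S.Const) : Formula S := .pred Pred.eq ![.const c, .const d]

/-- `A.subst x c` is `A(c/x)`: every free occurrence of `x` in `A` is replaced by the
constant `c`. -/
def subst (x : ℕ) (c : S.Const) : Formula S → Formula S
  | .pred P ts => .pred P (fun i => (ts i).subst x c)
  | .neg A => .neg (subst x c A)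
  | .and A B => .and (subst x c A) (subst x c B)
  | .or A B => .or (subst x c A) (subst x c B)
  | .all y A => .all y (if y = x then A else subst x c A)
  | .ex y A => .ex y (if y = x then A else subst x c A)

/-- The variable `x` occurs free in the formula. -/
def FreeIn (x : ℕ) : Formula S → Prop
  | .pred _ ts => ∃ i, ts i = .var x
  | .neg A => FreeIn x A
  | .and A B => FreeIn x A ∨ FreeIn x B
  | .or A B => FreeIn x A ∨ FreeIn x B
  | .all y A => x ≠ y ∧ FreeIn x A
  | .ex y A => x ≠ y ∧ FreeIn x A

/-- No quantifier in the formula is void: in every subformula `∀xA` or `∃xA` the variable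
`x` is free in `A`. -/
def NonVoid : Formula S → Prop
  | .pred _ _ => True
  | .neg A => NonVoid A
  | .and A B => NonVoid A ∧ NonVoid B
  | .or A B => NonVoid A ∧ NonVoid B
  | .all x A => FreeIn x A ∧ NonVoid A
  | .ex x A => FreeIn x A ∧ NonVoid A

/-- The constant `c` occurs in the formula. -/
def Occurs (c : S.Const) : Formula S → Prop
  | .pred _ ts => ∃ i, ts i = .const c
  | .neg A => Occurs c A
  | .and A B => Occurs c A ∨ Occurs c B
  | .or A B => Occurs c A ∨ Occurs c B
  | .all _ A => Occurs c A
  | .ex _ A => Occurs c A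

/-- Sentences: formulas without void quantifiers and without free variables. -/
def IsSentence (A : Formula S) : Prop := A.NonVoid ∧ ∀ x, ¬ A.FreeIn x

/-- The number of connectives and quantifiers of a formula. -/
def size : Formula S → ℕ
  | .pred _ _ => 0
  | .neg A => size A + 1
  | .and A B => size A + size B + 1
  | .or A B => size A + size B + 1
  | .all _ A => size A + 1
  | .ex _ A => size A + 1

theorem freeIn_subst (x y : ℕ) (c : S.Const) (A : Formula S) :
    (A.subst x c).FreeIn y ↔ y ≠ x ∧ A.FreeIn y := by
  induction A with
  | pred P ts =>
    simp only [subst, FreeIn]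
    constructor
    · rintro ⟨i, hi⟩
      cases h : ts i with
      | var z =>
        rw [h] at hi
        simp only [Term.subst] at hi
        split_ifs at hi with hz
        simp only [Term.var.injEq] at hi
        subst hi
        exact ⟨hz, i, h⟩
      | const d => rw [h] at hi; simp [Term.subst] at hi
    · rintro ⟨hy, i, hi⟩
      exact ⟨i, by simp [hi, Term.subst, hy]⟩
  | neg A ih => simpa [subst, FreeIn] using ih
  | and A B ihA ihB => simp only [subst, FreeIn, ihA, ihB]; tauto
  | or A B ihA ihB => simp only [subst, FreeIn, ihA, ihB]; tauto
  | all z A ih =>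
    by_cases hz : z = x
    · subst hz; simp [subst, FreeIn]
    · simp only [subst, hz, if_false, FreeIn, ih]; tauto
  | ex z A ih =>
    by_cases hz : z = x
    · subst hz; simp [subst, FreeIn]
    · simp only [subst, hz, if_false, FreeIn, ih]; tauto

theorem NonVoid.subst {A : Formula S} (h : A.NonVoid) (x : ℕ) (c : S.Const) :
    (A.subst x c).NonVoid := by
  induction A with
  | pred P ts => trivial
  | neg A ih => exact ih h
  | and A B ihA ihB => exact ⟨ihA h.1, ihB h.2⟩
  | or A B ihA ihB => exact ⟨ihA h.1, ihB h.2⟩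
  | all z A ih =>
    by_cases hz : z = x
    · simpa [Formula.subst, hz] using h
    · simp only [Formula.subst, hz, if_false]
      exact ⟨(freeIn_subst x z c A).2 ⟨hz, h.1⟩, ih h.2⟩
  | ex z A ih =>
    by_cases hz : z = x
    · simpa [Formula.subst, hz] using h
    · simp only [Formula.subst, hz, if_false]
      exact ⟨(freeIn_subst x z c A).2 ⟨hz, h.1⟩, ih h.2⟩

theorem size_subst (x : ℕ) (c : S.Const) (A : Formula S) : (A.subst x c).size = A.size := by
  induction A with
  | pred P ts => rfl
  | neg A ih => simp [subst, size, ih]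
  | and A B ihA ihB => simp [subst, size, ihA, ihB]
  | or A B ihA ihB => simp [subst, size, ihA, ihB]
  | all z A ih => by_cases hz : z = x <;> simp [subst, size, hz, ih]
  | ex z A ih => by_cases hz : z = x <;> simp [subst, size, hz, ih]

namespace IsSentence

theorem neg {A : Formula S} (h : A.IsSentence) : A.neg.IsSentence := h

theorem of_neg {A : Formula S} (h : A.neg.IsSentence) : A.IsSentence := h

theorem and_left {A B : Formula S} (h : (A.and B).IsSentence) : A.IsSentence :=
  ⟨h.1.1, fun x hx => h.2 x (Or.inl hx)⟩

theorem and_right {A B : Formula S} (h : (A.and B).IsSentence) : B.IsSentence :=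
  ⟨h.1.2, fun x hx => h.2 x (Or.inr hx)⟩

theorem or_left {A B : Formula S} (h : (A.or B).IsSentence) : A.IsSentence :=
  ⟨h.1.1, fun x hx => h.2 x (Or.inl hx)⟩

theorem or_right {A B : Formula S} (h : (A.or B).IsSentence) : B.IsSentence :=
  ⟨h.1.2, fun x hx => h.2 x (Or.inr hx)⟩

theorem all_inst {x : ℕ} {A : Formula S} (h : (A.all x).IsSentence) (c : S.Const) :
    (A.subst x c).IsSentence :=
  ⟨h.1.2.subst x c, fun y hy => h.2 y ((freeIn_subst x y c A).1 hy)⟩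

theorem ex_inst {x : ℕ} {A : Formula S} (h : (A.ex x).IsSentence) (c : S.Const) :
    (A.subst x c).IsSentence :=
  ⟨h.1.2.subst x c, fun y hy => h.2 y ((freeIn_subst x y c A).1 hy)⟩

theorem pred_const {n : ℕ} (P : S.Pred n) (c : Fin n → S.Const) :
    (Formula.pred P (fun i => Term.const (c i)) : Formula S).IsSentence :=
  ⟨trivial, by rintro x ⟨i, hi⟩; cases hi⟩

end IsSentence

end Formula

/-- `Sentence S` is the set `Sent(S)` of sentences generated by the signature. -/
abbrev Sentence (S : Signature.{u, v}) : Type (max u v) := {A : Formula S // A.IsSentence}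

/-! ### The deductive systems -/

/-- Names of the three extensions of `QFDE`. -/
inductive ExtLogic
  | QLP
  | QK3
  | QCL

/-- The logics that have the rule `PEM`. -/
def ExtLogic.HasPEM : ExtLogic → Prop
  | .QLP => True
  | .QK3 => False
  | .QCL => True

/-- The logics that have the rule `EXP`. -/
def ExtLogic.HasEXP : ExtLogic → Prop
  | .QLP => False
  | .QK3 => True
  | .QCL => True

open Formula in
/-- `Derivation L Γ A`: there is a natural deduction derivation (a tree of sentences) in the
logic `L` whose conclusion is `A` and whose set of undischarged hypotheses, i.e. the set of
hypotheses on which `A` depends, is exactly `Γ`. All nodes are sentences. The rules are those of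
`QFDE`, followed by `PEM` and `EXP` for the logics that have them. -/
inductive Derivation (L : ExtLogic) : Set (Formula S) → Formula S → Prop
  | hyp {A : Formula S} (hA : A.IsSentence) : Derivation L {A} A
  | andI {Γ Δ : Set (Formula S)} {A B : Formula S} : Derivation L Γ A → Derivation L Δ B →
      Derivation L (Γ ∪ Δ) (and A B)
  | andE₁ {Γ : Set (Formula S)} {A B : Formula S} : Derivation L Γ (and A B) → Derivation L Γ A
  | andE₂ {Γ : Set (Formula S)} {A B : Formula S} : Derivation L Γ (and A B) → Derivation L Γ B
  | orI₁ {Γ : Set (Formula S)} {A B : Formula S} (hB : B.IsSentence) : Derivation L Γ A →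
      Derivation L Γ (or A B)
  | orI₂ {Γ : Set (Formula S)} {A B : Formula S} (hA : A.IsSentence) : Derivation L Γ B →
      Derivation L Γ (or A B)
  | orE {Γ Δ₁ Δ₂ : Set (Formula S)} {A B C : Formula S} : Derivation L Γ (or A B) →
      Derivation L Δ₁ C → Derivation L Δ₂ C →
      Derivation L (Γ ∪ (Δ₁ \ {A}) ∪ (Δ₂ \ {B})) C
  | negAndI₁ {Γ : Set (Formula S)} {A B : Formula S} (hB : B.IsSentence) :
      Derivation L Γ (neg A) →
      Derivation L Γ (neg (and A B))
  | negAndI₂ {Γ : Set (Formula S)} {A B : Formula S} (hA : A.IsSentence) :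
      Derivation L Γ (neg B) →
      Derivation L Γ (neg (and A B))
  | negAndE {Γ Δ₁ Δ₂ : Set (Formula S)} {A B C : Formula S} : Derivation L Γ (neg (and A B)) →
      Derivation L Δ₁ C →
      Derivation L Δ₂ C → Derivation L (Γ ∪ (Δ₁ \ {neg A}) ∪ (Δ₂ \ {neg B})) C
  | negOrI {Γ Δ : Set (Formula S)} {A B : Formula S} : Derivation L Γ (neg A) →
      Derivation L Δ (neg B) →
      Derivation L (Γ ∪ Δ) (neg (or A B))
  | negOrE₁ {Γ : Set (Formula S)} {A B : Formula S} : Derivation L Γ (neg (or A B)) →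
      Derivation L Γ (neg A)
  | negOrE₂ {Γ : Set (Formula S)} {A B : Formula S} : Derivation L Γ (neg (or A B)) →
      Derivation L Γ (neg B)
  | dnI {Γ : Set (Formula S)} {A : Formula S} : Derivation L Γ A → Derivation L Γ (neg (neg A))
  | dnE {Γ : Set (Formula S)} {A : Formula S} : Derivation L Γ (neg (neg A)) → Derivation L Γ A
  | allI {Γ : Set (Formula S)} {A B : Formula S} {x : ℕ} {c : S.Const}
      (hA : (all x A).IsSentence) (hcA : ¬ A.Occurs c) (hcB : ¬ B.Occurs c)
      (hcΓ : ∀ D ∈ Γ, ¬ D.Occurs c) :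
      Derivation L Γ (or B (A.subst x c)) → Derivation L Γ (or B (all x A))
  | allE {Γ : Set (Formula S)} {A : Formula S} {x : ℕ} (c : S.Const) : Derivation L Γ (all x A) →
      Derivation L Γ (A.subst x c)
  | exI {Γ : Set (Formula S)} {A : Formula S} {x : ℕ} {c : S.Const} (hA : (ex x A).IsSentence) :
      Derivation L Γ (A.subst x c) → Derivation L Γ (ex x A)
  | exE {Γ Δ : Set (Formula S)} {A C : Formula S} {x : ℕ} {c : S.Const} (hcA : ¬ A.Occurs c)
      (hcC : ¬ C.Occurs c)
      (hcΔ : ∀ D ∈ Δ \ {A.subst x c}, ¬ D.Occurs c) :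
      Derivation L Γ (ex x A) → Derivation L Δ C → Derivation L (Γ ∪ (Δ \ {A.subst x c})) C
  | negAllI {Γ : Set (Formula S)} {A : Formula S} {x : ℕ} {c : S.Const}
      (hA : (all x A).IsSentence) :
      Derivation L Γ (neg (A.subst x c)) → Derivation L Γ (neg (all x A))
  | negAllE {Γ Δ : Set (Formula S)} {A C : Formula S} {x : ℕ} {c : S.Const}
      (hcA : ¬ A.Occurs c) (hcC : ¬ C.Occurs c)
      (hcΔ : ∀ D ∈ Δ \ {neg (A.subst x c)}, ¬ D.Occurs c) :
      Derivation L Γ (neg (all x A)) → Derivation L Δ C →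
      Derivation L (Γ ∪ (Δ \ {neg (A.subst x c)})) C
  | negExI {Γ : Set (Formula S)} {A : Formula S} {x : ℕ} {c : S.Const}
      (hA : (ex x A).IsSentence) (hcA : ¬ A.Occurs c)
      (hcΓ : ∀ D ∈ Γ, ¬ D.Occurs c) :
      Derivation L Γ (neg (A.subst x c)) → Derivation L Γ (neg (ex x A))
  | negExE {Γ : Set (Formula S)} {A : Formula S} {x : ℕ} (c : S.Const) :
      Derivation L Γ (neg (ex x A)) → Derivation L Γ (neg (A.subst x c))
  | eqI (c : S.Const) : Derivation L ∅ (eqn c c)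
  | eqE {Γ Δ : Set (Formula S)} {A : Formula S} {x : ℕ} {c₁ c₂ : S.Const} :
      Derivation L Γ (eqn c₁ c₂) → Derivation L Δ (A.subst x c₁) →
      Derivation L (Γ ∪ Δ) (A.subst x c₂)
  | pem {A : Formula S} (hL : L.HasPEM) (hA : A.IsSentence) : Derivation L ∅ (or A (neg A))
  | exp {Γ Δ : Set (Formula S)} {A B : Formula S} (hL : L.HasEXP) (hB : B.IsSentence) :
      Derivation L Γ A →
      Derivation L Δ (neg A) → Derivation L (Γ ∪ Δ) B

/-- `Γ ⊢ A` in the logic `L`: some derivation has conclusion `A` and all its undischarged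
hypotheses in `Γ`. -/
def Provable (L : ExtLogic) (Γ : Set (Sentence S)) (A : Sentence S) : Prop :=
  ∃ Γ₀ : Set (Formula S), Γ₀ ⊆ Subtype.val '' Γ ∧ Derivation L Γ₀ A.val

/-! ### Structures -/

/-- A structure: a non-empty domain, an element of the domain for each constant, and for each
`n`-ary predicate letter an extension and an anti-extension, both sets of `n`-tuples. The
extension of `≈` is the identity relation; its anti-extension is arbitrary. -/
structure Structure (S : Signature.{u, v}) where
  D : Type w
  nonempty : Nonempty D
  const : S.Const → D
  pos : ∀ {n : ℕ}, S.Pred n → Set (Fin n → D)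
  neg : ∀ {n : ℕ}, S.Pred n → Set (Fin n → D)
  pos_eq : pos Pred.eq = {a | a 0 = a 1}

/-- The diagram signature over the set `D`: a new constant is added for each element of `D`. -/
abbrev Signature.diagram (S : Signature.{u, v}) (D : Type w) : Signature.{max u w, v} where
  Const := S.Const ⊕ D
  Rel := S.Rel
  infinite_const := haveI := S.infinite_const; inferInstance

/-- A term of the signature as a term of the diagram signature. -/
def Term.toDiagram (D : Type w) : Term S → Term (S.diagram D)
  | .var x => .var x
  | .const c => .const (Sum.inl c)

/-- A formula of the signature as a formula of the diagram signature. -/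
def Formula.toDiagram (D : Type w) : Formula S → Formula (S.diagram D)
  | .pred P ts => .pred P (fun i => (ts i).toDiagram D)
  | .neg A => .neg (toDiagram D A)
  | .and A B => .and (toDiagram D A) (toDiagram D B)
  | .or A B => .or (toDiagram D A) (toDiagram D B)
  | .all x A => .all x (toDiagram D A)
  | .ex x A => .ex x (toDiagram D A)

theorem Formula.freeIn_toDiagram (D : Type w) (x : ℕ) (A : Formula S) :
    (A.toDiagram D).FreeIn x ↔ A.FreeIn x := by
  induction A with
  | pred P ts =>
    simp only [toDiagram, FreeIn]
    refine exists_congr fun i => ?_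
    cases ts i <;> simp [Term.toDiagram]
  | neg A ih => simpa [toDiagram, FreeIn] using ih
  | and A B ihA ihB => simp [toDiagram, FreeIn, ihA, ihB]
  | or A B ihA ihB => simp [toDiagram, FreeIn, ihA, ihB]
  | all z A ih => simp [toDiagram, FreeIn, ih]
  | ex z A ih => simp [toDiagram, FreeIn, ih]

theorem Formula.nonVoid_toDiagram (D : Type w) (A : Formula S) :
    (A.toDiagram D).NonVoid ↔ A.NonVoid := by
  induction A with
  | pred P ts => simp [toDiagram, NonVoid]
  | neg A ih => simpa [toDiagram, NonVoid] using ih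
  | and A B ihA ihB => simp [toDiagram, NonVoid, ihA, ihB]
  | or A B ihA ihB => simp [toDiagram, NonVoid, ihA, ihB]
  | all z A ih => simp [toDiagram, NonVoid, ih, freeIn_toDiagram]
  | ex z A ih => simp [toDiagram, NonVoid, ih, freeIn_toDiagram]

/-- The inclusion of `Sent(S)` in the set of sentences of the diagram language. -/
def Sentence.toDiagram (D : Type w) (A : Sentence S) : Sentence (S.diagram D) :=
  ⟨A.val.toDiagram D, (A.val.nonVoid_toDiagram D).2 A.2.1,
    fun x hx => A.2.2 x ((A.val.freeIn_toDiagram D x).1 hx)⟩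

namespace Structure

variable (𝔄 : Structure.{u, v, w} S)

/-- The interpretation of the constants of the diagram language: the new constant of `a`
denotes `a`. -/
def diagConst : S.Const ⊕ 𝔄.D → 𝔄.D := Sum.elim 𝔄.const id

/-- `v` is a valuation induced by `𝔄`: it maps the sentences of the diagram language of `𝔄` to
`{0, 1}` (here `Bool`) and satisfies the following clauses. -/
structure IsInducedValuation (v : Sentence (S.diagram 𝔄.D) → Bool) : Prop where
  pred : ∀ {n : ℕ} (P : S.Pred n) (c : Fin n → S.Const ⊕ 𝔄.D),
    v ⟨.pred P (fun i => .const (c i)), .pred_const (S := S.diagram 𝔄.D) P c⟩ = true ↔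
      (fun i => 𝔄.diagConst (c i)) ∈ 𝔄.pos P
  neg_pred : ∀ {n : ℕ} (P : S.Pred n) (c : Fin n → S.Const ⊕ 𝔄.D),
    v ⟨.neg (.pred P (fun i => .const (c i))),
        .neg (.pred_const (S := S.diagram 𝔄.D) P c)⟩ = true ↔
      (fun i => 𝔄.diagConst (c i)) ∈ 𝔄.neg P
  and : ∀ (A B : Formula (S.diagram 𝔄.D)) (h : (A.and B).IsSentence),
    v ⟨A.and B, h⟩ = true ↔ v ⟨A, h.and_left⟩ = true ∧ v ⟨B, h.and_right⟩ = true
  or : ∀ (A B : Formula (S.diagram 𝔄.D)) (h : (A.or B).IsSentence),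
    v ⟨A.or B, h⟩ = true ↔ v ⟨A, h.or_left⟩ = true ∨ v ⟨B, h.or_right⟩ = true
  neg_and : ∀ (A B : Formula (S.diagram 𝔄.D)) (h : (A.and B).IsSentence),
    v ⟨(A.and B).neg, h.neg⟩ = true ↔
      v ⟨A.neg, h.and_left.neg⟩ = true ∨ v ⟨B.neg, h.and_right.neg⟩ = true
  neg_or : ∀ (A B : Formula (S.diagram 𝔄.D)) (h : (A.or B).IsSentence),
    v ⟨(A.or B).neg, h.neg⟩ = true ↔
      v ⟨A.neg, h.or_left.neg⟩ = true ∧ v ⟨B.neg, h.or_right.neg⟩ = true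
  neg_neg : ∀ (A : Formula (S.diagram 𝔄.D)) (h : A.IsSentence),
    v ⟨A.neg.neg, h.neg.neg⟩ = true ↔ v ⟨A, h⟩ = true
  all : ∀ (x : ℕ) (A : Formula (S.diagram 𝔄.D)) (h : (A.all x).IsSentence),
    v ⟨A.all x, h⟩ = true ↔
      ∀ a : 𝔄.D, v ⟨A.subst x (Sum.inr a), h.all_inst (Sum.inr a)⟩ = true
  ex : ∀ (x : ℕ) (A : Formula (S.diagram 𝔄.D)) (h : (A.ex x).IsSentence),
    v ⟨A.ex x, h⟩ = true ↔
      ∃ a : 𝔄.D, v ⟨A.subst x (Sum.inr a), h.ex_inst (Sum.inr a)⟩ = true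
  neg_all : ∀ (x : ℕ) (A : Formula (S.diagram 𝔄.D)) (h : (A.all x).IsSentence),
    v ⟨(A.all x).neg, h.neg⟩ = true ↔
      ∃ a : 𝔄.D, v ⟨(A.subst x (Sum.inr a)).neg, (h.all_inst (Sum.inr a)).neg⟩ = true
  neg_ex : ∀ (x : ℕ) (A : Formula (S.diagram 𝔄.D)) (h : (A.ex x).IsSentence),
    v ⟨(A.ex x).neg, h.neg⟩ = true ↔
      ∀ a : 𝔄.D, v ⟨(A.subst x (Sum.inr a)).neg, (h.ex_inst (Sum.inr a)).neg⟩ = true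

/-- Auxiliary, for the existence of the induced valuation: the value of a term under an
assignment of elements to variables. -/
def termVal (s : ℕ → 𝔄.D) : Term (S.diagram 𝔄.D) → 𝔄.D
  | .var x => s x
  | .const c => 𝔄.diagConst c

/-- Auxiliary, for the existence of the induced valuation: the satisfaction of `A` (sign `true`)
or of `¬A` (sign `false`) under an assignment of elements to variables. -/
def Sat : Formula (S.diagram 𝔄.D) → (ℕ → 𝔄.D) → Bool → Prop
  | .pred P ts, s, true => (fun i => 𝔄.termVal s (ts i)) ∈ 𝔄.pos P
  | .pred P ts, s, false => (fun i => 𝔄.termVal s (ts i)) ∈ 𝔄.neg P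
  | .neg A, s, b => Sat A s (!b)
  | .and A B, s, true => Sat A s true ∧ Sat B s true
  | .and A B, s, false => Sat A s false ∨ Sat B s false
  | .or A B, s, true => Sat A s true ∨ Sat B s true
  | .or A B, s, false => Sat A s false ∧ Sat B s false
  | .all x A, s, true => ∀ a, Sat A (Function.update s x a) true
  | .all x A, s, false => ∃ a, Sat A (Function.update s x a) false
  | .ex x A, s, true => ∃ a, Sat A (Function.update s x a) true
  | .ex x A, s, false => ∀ a, Sat A (Function.update s x a) false

theorem sat_subst (x : ℕ) (a : 𝔄.D) (A : Formula (S.diagram 𝔄.D)) (s : ℕ → 𝔄.D) (b : Bool) :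
    𝔄.Sat (A.subst x (Sum.inr a)) s b ↔ 𝔄.Sat A (Function.update s x a) b := by
  induction A generalizing s b with
  | pred P ts =>
    have h : ∀ t : Term (S.diagram 𝔄.D), 𝔄.termVal s (t.subst x (Sum.inr a)) =
        𝔄.termVal (Function.update s x a) t := by
      intro t
      cases t with
      | var y =>
        by_cases hy : y = x
        · subst hy; simp [Term.subst, termVal, diagConst]
        · simp [Term.subst, termVal, hy]
      | const d => rfl
    cases b <;> simp [Formula.subst, Sat, h]
  | neg A ih => simpa [Formula.subst, Sat] using ih s (!b)
  | and A B ihA ihB => cases b <;> simp [Formula.subst, Sat, ihA, ihB]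
  | or A B ihA ihB => cases b <;> simp [Formula.subst, Sat, ihA, ihB]
  | all z A ih =>
    by_cases hz : z = x
    · subst hz; cases b <;> simp [Formula.subst, Sat]
    · cases b <;> simp [Formula.subst, Sat, hz, ih, Function.update_comm hz]
  | ex z A ih =>
    by_cases hz : z = x
    · subst hz; cases b <;> simp [Formula.subst, Sat]
    · cases b <;> simp [Formula.subst, Sat, hz, ih, Function.update_comm hz]

theorem IsInducedValuation.iff_sat {v : Sentence (S.diagram 𝔄.D) → Bool}
    (hv : 𝔄.IsInducedValuation v) (s : ℕ → 𝔄.D) (k : ℕ) :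
    ∀ (A : Formula (S.diagram 𝔄.D)) (h : A.IsSentence), A.size = k →
      (v ⟨A, h⟩ = true ↔ 𝔄.Sat A s true) ∧ (v ⟨A.neg, h.neg⟩ = true ↔ 𝔄.Sat A s false) := by
  induction k using Nat.strong_induction_on with
  | _ k ih =>
  intro A h hk
  cases A with
  | @pred n P ts =>
    have hc : ∀ i, ∃ c, ts i = Term.const c := by
      intro i
      cases hi : ts i with
      | var x => exact absurd ⟨i, hi⟩ (h.2 x)
      | const c => exact ⟨c, rfl⟩
    choose c hc using hc
    obtain rfl : ts = fun i => Term.const (c i) := funext hc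
    exact ⟨hv.pred P c, hv.neg_pred P c⟩
  | neg A =>
    have ihA := ih A.size (by simp only [Formula.size] at hk; omega) A h.of_neg rfl
    refine ⟨?_, ?_⟩
    · simpa [Sat] using ihA.2
    · rw [hv.neg_neg A h.of_neg]; simpa [Sat] using ihA.1
  | and A B =>
    have ihA := ih A.size (by simp only [Formula.size] at hk; omega) A h.and_left rfl
    have ihB := ih B.size (by simp only [Formula.size] at hk; omega) B h.and_right rfl
    refine ⟨?_, ?_⟩
    · rw [hv.and A B h, ihA.1, ihB.1]; rfl
    · rw [hv.neg_and A B h, ihA.2, ihB.2]; rfl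
  | or A B =>
    have ihA := ih A.size (by simp only [Formula.size] at hk; omega) A h.or_left rfl
    have ihB := ih B.size (by simp only [Formula.size] at hk; omega) B h.or_right rfl
    refine ⟨?_, ?_⟩
    · rw [hv.or A B h, ihA.1, ihB.1]; rfl
    · rw [hv.neg_or A B h, ihA.2, ihB.2]; rfl
  | all x A =>
    have ihA := fun a : 𝔄.D => ih A.size (by simp only [Formula.size] at hk; omega)
      (A.subst x (Sum.inr a)) (h.all_inst (Sum.inr a)) (Formula.size_subst _ _ _)
    refine ⟨?_, ?_⟩
    · rw [hv.all x A h]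
      exact forall_congr' fun a => (ihA a).1.trans (𝔄.sat_subst x a A s true)
    · rw [hv.neg_all x A h]
      exact exists_congr fun a => (ihA a).2.trans (𝔄.sat_subst x a A s false)
  | ex x A =>
    have ihA := fun a : 𝔄.D => ih A.size (by simp only [Formula.size] at hk; omega)
      (A.subst x (Sum.inr a)) (h.ex_inst (Sum.inr a)) (Formula.size_subst _ _ _)
    refine ⟨?_, ?_⟩
    · rw [hv.ex x A h]
      exact exists_congr fun a => (ihA a).1.trans (𝔄.sat_subst x a A s true)
    · rw [hv.neg_ex x A h]
      exact forall_congr' fun a => (ihA a).2.trans (𝔄.sat_subst x a A s false)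

/-- To each structure there corresponds exactly one induced valuation. -/
theorem existsUnique_inducedValuation :
    ∃! v : Sentence (S.diagram 𝔄.D) → Bool, 𝔄.IsInducedValuation v := by
  classical
  obtain ⟨d⟩ := 𝔄.nonempty
  let s : ℕ → 𝔄.D := fun _ => d
  refine ⟨fun A => decide (𝔄.Sat A.val s true), ?_, ?_⟩
  · constructor <;> intros <;> rw [decide_eq_true_eq] <;> simp [sat_subst, Sat, termVal]
  · intro v hv
    funext A
    have h := (hv.iff_sat 𝔄 s _ A.val A.2 rfl).1
    by_cases hA : v A = true
    · rw [hA]; exact (decide_eq_true (h.1 hA)).symm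
    · rw [Bool.not_eq_true] at hA
      rw [hA]; exact (decide_eq_false fun h' => by simp [h.2 h'] at hA).symm

/-- The valuation induced by `𝔄`. -/
noncomputable def valuation : Sentence (S.diagram 𝔄.D) → Bool :=
  𝔄.existsUnique_inducedValuation.choose

theorem valuation_isInduced : 𝔄.IsInducedValuation 𝔄.valuation :=
  𝔄.existsUnique_inducedValuation.choose_spec.1

/-- `𝔄 ⊨ A`: the induced valuation of `𝔄` gives the sentence `A` the value `1`. -/
def Holds (A : Sentence S) : Prop := 𝔄.valuation (A.toDiagram 𝔄.D) = true

/-- Extension and anti-extension of each predicate letter (`≈` included) together exhaust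
the set of all `n`-tuples. -/
def IsExhaustive : Prop := ∀ (n : ℕ) (P : S.Pred n), 𝔄.pos P ∪ 𝔄.neg P = Set.univ

/-- Extension and anti-extension of each predicate letter (`≈` included) are disjoint. -/
def IsExclusive : Prop := ∀ (n : ℕ) (P : S.Pred n), 𝔄.pos P ∩ 𝔄.neg P = ∅

end Structure

/-- The structures for each of the three logics. -/
def ExtLogic.IsStructure : ExtLogic → Structure.{u, v, w} S → Prop
  | .QLP, 𝔄 => 𝔄.IsExhaustive
  | .QK3, 𝔄 => 𝔄.IsExclusive
  | .QCL, 𝔄 => 𝔄.IsExhaustive ∧ 𝔄.IsExclusive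

/-- `A` is a semantic consequence of `Γ` in `L`: it holds in every structure for `L`
(with domain in `Type w`) in which every member of `Γ` holds. -/
def Consequence (L : ExtLogic) (Γ : Set (Sentence S)) (A : Sentence S) : Prop :=
  ∀ 𝔄 : Structure.{u, v, w} S, L.IsStructure 𝔄 → (∀ B ∈ Γ, 𝔄.Holds B) → 𝔄.Holds A

end QFDE

/-!
Soundness is an induction on derivations (`Derivation.sound`), in which the structure varies: at a
rule with an eigenconstant, the constant is reinterpreted, which does not affect formulas in which
it does not occur.

Completeness is a Henkin argument for prime theories, as there is no implication and no classical
negation to work with. If `A` is not derivable from `Γ`, there is a set `T` of sentences that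
includes `Γ`, omits `A`, is closed under derivability, is prime (contains a disjunct of each of its
disjunctions) and has witnesses on both sides: an example for each `∃xB` and `¬∀xB` in `T`, and a
counterexample for each `∀xB` and `¬∃xB` not in `T`. The constants of the language modulo the
equations in `T`, with the literals in `T` as extensions and anti-extensions, then form a structure
in which precisely the members of `T` hold (`IsPrimeTheory.isInducedValuation`). Closure under `PEM`
makes it exhaustive, and closure under `EXP` makes it exclusive, as `T` omits a sentence.

To have enough constants for languages of any cardinality, the theory `T` is built in a language
whose constants include codes of all formulas of that same language (`HenkinConst`), so that the
witness for a sentence is its own code. Underivability carries over from the original language,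
since derivations survive any renaming of the constants once their eigenconstants have been made
fresh (`Derivation.prov_map`). A single fresh constant can always be made a witness for a given
sentence: examples by the rules `∃E` and `¬∀E`, counterexamples by `∀I`, whose side disjunct `B`
is what makes this possible, and by the analogue for `¬∃` derivable from it
(`Separable.exists_witnesses`). Finitely many sentences are handled in the order of the depth of
their codes, followed by Zorn's lemma for primeness (`Separable.exists_forall_witnesses`). The
theories obtained for the various finite sets of sentences are combined along an ultrafilter; this
preserves closure under derivability because derivations have finitely many hypotheses
(`Separable.exists_henkinTheory`).
-/

namespace QFDE

variable {S : Signature.{u, v}}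

/-! ### Renaming constants -/

/-- The signature with the same predicate letters as `S` and with `C` as set of constants. -/
abbrev Signature.withConst (S : Signature.{u, v}) (C : Type w) [h : Infinite C] :
    Signature.{w, v} where
  Const := C
  Rel := S.Rel
  infinite_const := h

section Map

variable {C : Type w} [Infinite C]

/-- Replace each constant `c` of a term by `f c`. -/
def Term.map (f : S.Const → C) : Term S → Term (S.withConst C)
  | .var x => .var x
  | .const c => .const (f c)

namespace Formula

/-- Replace each constant `c` of a formula by `f c`. -/
def map (f : S.Const → C) : Formula S → Formula (S.withConst C)
  | .pred P ts => .pred P (fun i => (ts i).map f)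
  | .neg A => .neg (map f A)
  | .and A B => .and (map f A) (map f B)
  | .or A B => .or (map f A) (map f B)
  | .all x A => .all x (map f A)
  | .ex x A => .ex x (map f A)

theorem map_subst (f : S.Const → C) (x : ℕ) (c : S.Const) (A : Formula S) :
    (A.subst x c).map f = (A.map f).subst x (f c) := by
  induction A with
  | pred P ts =>
    simp only [subst, map]
    congr 1
    funext i
    cases ts i with
    | var y => by_cases hy : y = x <;> simp [Term.subst, Term.map, hy]
    | const d => rfl
  | neg A ih => simp [subst, map, ih]
  | and A B ihA ihB => simp [subst, map, ihA, ihB]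
  | or A B ihA ihB => simp [subst, map, ihA, ihB]
  | all z A ih => by_cases hz : z = x <;> simp [subst, map, hz, ih]
  | ex z A ih => by_cases hz : z = x <;> simp [subst, map, hz, ih]

theorem freeIn_map (f : S.Const → C) (x : ℕ) (A : Formula S) :
    (A.map f).FreeIn x ↔ A.FreeIn x := by
  induction A with
  | pred P ts =>
    simp only [map, FreeIn]
    refine exists_congr fun i => ?_
    cases ts i <;> simp [Term.map]
  | neg A ih => simpa [map, FreeIn] using ih
  | and A B ihA ihB => simp [map, FreeIn, ihA, ihB]
  | or A B ihA ihB => simp [map, FreeIn, ihA, ihB]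
  | all z A ih => simp [map, FreeIn, ih]
  | ex z A ih => simp [map, FreeIn, ih]

theorem nonVoid_map (f : S.Const → C) (A : Formula S) : (A.map f).NonVoid ↔ A.NonVoid := by
  induction A with
  | pred P ts => simp [map, NonVoid]
  | neg A ih => simpa [map, NonVoid] using ih
  | and A B ihA ihB => simp [map, NonVoid, ihA, ihB]
  | or A B ihA ihB => simp [map, NonVoid, ihA, ihB]
  | all z A ih => simp [map, NonVoid, ih, freeIn_map]
  | ex z A ih => simp [map, NonVoid, ih, freeIn_map]

theorem IsSentence.map {A : Formula S} (h : A.IsSentence) (f : S.Const → C) :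
    (A.map f).IsSentence :=
  ⟨(nonVoid_map f A).2 h.1, fun x hx => h.2 x ((freeIn_map f x A).1 hx)⟩

theorem map_congr {f g : S.Const → C} {A : Formula S} (h : ∀ c, A.Occurs c → f c = g c) :
    A.map f = A.map g := by
  induction A with
  | pred P ts =>
    simp only [map]
    congr 1
    funext i
    cases hi : ts i with
    | var y => rfl
    | const d => simp [Term.map, h d ⟨i, hi⟩]
  | neg A ih => simp [map, ih h]
  | and A B ihA ihB =>
    simp [map, ihA fun c hc => h c (Or.inl hc), ihB fun c hc => h c (Or.inr hc)]
  | or A B ihA ihB =>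
    simp [map, ihA fun c hc => h c (Or.inl hc), ihB fun c hc => h c (Or.inr hc)]
  | all z A ih => simp [map, ih h]
  | ex z A ih => simp [map, ih h]

theorem map_update [DecidableEq S.Const] (f : S.Const → C) {c : S.Const} (d : C) {A : Formula S}
    (h : ¬ A.Occurs c) : A.map (Function.update f c d) = A.map f :=
  map_congr fun e he => Function.update_of_ne (by rintro rfl; exact h he) _ _

/-- The left-hand side renames back into the original signature, which is definitionally
`(S.withConst C).withConst S.Const`. -/
theorem map_map_leftInverse {f : S.Const → C} {g : C → S.Const} (h : Function.LeftInverse g f)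
    (A : Formula S) :
    haveI := S.infinite_const
    (map (S := S.withConst C) g (A.map f) : Formula S) = A := by
  induction A with
  | pred P ts =>
    simp only [map]
    congr 1
    funext i
    cases ts i with
    | var y => rfl
    | const d => simp [Term.map, h d]
  | neg A ih => simp only [map, ih]
  | and A B ihA ihB => simp only [map, ihA, ihB]
  | or A B ihA ihB => simp only [map, ihA, ihB]
  | all z A ih => simp only [map, ih]
  | ex z A ih => simp only [map, ih]

theorem Occurs.of_map {f : S.Const → C} {A : Formula S} {d : C} (h : (A.map f).Occurs d) :
    ∃ c, f c = d ∧ A.Occurs c := by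
  induction A with
  | pred P ts =>
    obtain ⟨i, hi⟩ := h
    dsimp only at hi
    cases ht : ts i with
    | var y => rw [ht] at hi; cases hi
    | const c =>
      rw [ht] at hi
      simp only [Term.map, Term.const.injEq] at hi
      exact ⟨c, hi, i, ht⟩
  | neg A ih => exact ih h
  | and A B ihA ihB =>
    rcases h with h | h
    · obtain ⟨c, hc, ho⟩ := ihA h; exact ⟨c, hc, Or.inl ho⟩
    · obtain ⟨c, hc, ho⟩ := ihB h; exact ⟨c, hc, Or.inr ho⟩
  | or A B ihA ihB =>
    rcases h with h | h
    · obtain ⟨c, hc, ho⟩ := ihA h; exact ⟨c, hc, Or.inl ho⟩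
    · obtain ⟨c, hc, ho⟩ := ihB h; exact ⟨c, hc, Or.inr ho⟩
  | all z A ih => exact ih h
  | ex z A ih => exact ih h

end Formula

end Map

/-! ### Occurrences of constants -/

namespace Formula

theorem finite_occurs (A : Formula S) : {c | A.Occurs c}.Finite := by
  induction A with
  | pred P ts =>
    have h : {c | ∃ i, ts i = Term.const c} ⊆
        ⋃ i, {c | ts i = Term.const c} := fun c hc => by simpa using hc
    refine (Set.finite_iUnion fun i => ?_).subset h
    exact Set.Subsingleton.finite fun c hc d hd => by
      simpa using (show ts i = _ from hc).symm.trans hd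
  | neg A ih => exact ih
  | and A B ihA ihB => exact ihA.union ihB
  | or A B ihA ihB => exact ihA.union ihB
  | all z A ih => exact ih
  | ex z A ih => exact ih

theorem exists_fresh {Γ : Set (Formula S)} (h : Γ.Finite) : ∃ c, ∀ D ∈ Γ, ¬ D.Occurs c := by
  have := S.infinite_const
  obtain ⟨c, hc⟩ := (h.biUnion fun D _ => finite_occurs D).exists_notMem
  exact ⟨c, fun D hD ho => hc (Set.mem_biUnion hD ho)⟩

theorem Occurs.of_subst {x : ℕ} {c d : S.Const} {A : Formula S} (h : (A.subst x c).Occurs d) :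
    d = c ∨ A.Occurs d := by
  induction A with
  | pred P ts =>
    obtain ⟨i, hi⟩ := h
    dsimp only at hi
    cases ht : ts i with
    | var y =>
      rw [ht] at hi
      simp only [Term.subst] at hi
      split_ifs at hi
      exact Or.inl (Term.const.inj hi).symm
    | const e =>
      rw [ht] at hi
      exact Or.inr ⟨i, ht.trans hi⟩
  | neg A ih => exact ih h
  | and A B ihA ihB =>
    rcases h with h | h
    · exact (ihA h).imp_right Or.inl
    · exact (ihB h).imp_right Or.inr
  | or A B ihA ihB =>
    rcases h with h | h
    · exact (ihA h).imp_right Or.inl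
    · exact (ihB h).imp_right Or.inr
  | all z A ih =>
    by_cases hz : z = x
    · simp only [subst, hz, if_true] at h; exact Or.inr h
    · simp only [subst, hz, if_false] at h; exact ih h
  | ex z A ih =>
    by_cases hz : z = x
    · simp only [subst, hz, if_true] at h; exact Or.inr h
    · simp only [subst, hz, if_false] at h; exact ih h

theorem NonVoid.of_subst {A : Formula S} {x : ℕ} {c : S.Const} (h : (A.subst x c).NonVoid) :
    A.NonVoid := by
  induction A with
  | pred P ts => trivial
  | neg A ih => exact ih h
  | and A B ihA ihB => exact ⟨ihA h.1, ihB h.2⟩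
  | or A B ihA ihB => exact ⟨ihA h.1, ihB h.2⟩
  | all z A ih =>
    by_cases hz : z = x
    · simpa [Formula.subst, hz] using h
    · simp only [Formula.subst, hz, if_false] at h
      exact ⟨((freeIn_subst x z c A).1 h.1).2, ih h.2⟩
  | ex z A ih =>
    by_cases hz : z = x
    · simpa [Formula.subst, hz] using h
    · simp only [Formula.subst, hz, if_false] at h
      exact ⟨((freeIn_subst x z c A).1 h.1).2, ih h.2⟩

theorem IsSentence.subst_congr {A : Formula S} {x : ℕ} {c : S.Const}
    (h : (A.subst x c).IsSentence) (d : S.Const) : (A.subst x d).IsSentence :=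
  ⟨h.1.of_subst.subst x d, fun y hy =>
    h.2 y ((freeIn_subst x y c A).2 ((freeIn_subst x y d A).1 hy))⟩

theorem isSentence_eqn (c d : S.Const) : (eqn c d).IsSentence :=
  ⟨trivial, by rintro x ⟨i, hi⟩; fin_cases i <;> cases hi⟩

end Formula

/-! ### Derivability from a set of formulas -/

section Prov

open Formula

variable {L : ExtLogic}

theorem Derivation.finite {Γ : Set (Formula S)} {A : Formula S} (h : Derivation L Γ A) :
    Γ.Finite := by
  induction h with
  | hyp => exact Set.finite_singleton _
  | andI _ _ ih₁ ih₂ | negOrI _ _ ih₁ ih₂ | eqE _ _ ih₁ ih₂ | exp _ _ _ _ ih₁ ih₂ =>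
    exact ih₁.union ih₂
  | orE _ _ _ ih ih₁ ih₂ | negAndE _ _ _ ih ih₁ ih₂ => exact (ih.union ih₁.sdiff).union ih₂.sdiff
  | exE _ _ _ _ _ ih ih₁ | negAllE _ _ _ _ _ ih ih₁ => exact ih.union ih₁.sdiff
  | eqI | pem => exact Set.finite_empty
  | _ => assumption

theorem Derivation.isSentence {Γ : Set (Formula S)} {A : Formula S} (h : Derivation L Γ A) :
    A.IsSentence := by
  have key : ∀ {A B : Formula S}, A.IsSentence → B.IsSentence → (A.or B).IsSentence :=
    fun hA hB => ⟨⟨hA.1, hB.1⟩, fun x hx => hx.elim (hA.2 x) (hB.2 x)⟩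
  induction h with
  | hyp hA => exact hA
  | andI _ _ ih₁ ih₂ => exact key ih₁ ih₂
  | andE₁ _ ih => exact ih.and_left
  | andE₂ _ ih => exact ih.and_right
  | orI₁ hB _ ih => exact key ih hB
  | orI₂ hA _ ih => exact key hA ih
  | orE _ _ _ _ ih _ => exact ih
  | negAndI₁ hB _ ih => exact key ih hB
  | negAndI₂ hA _ ih => exact key hA ih
  | negAndE _ _ _ _ ih _ => exact ih
  | negOrI _ _ ih₁ ih₂ => exact key ih₁ ih₂
  | negOrE₁ _ ih => exact (IsSentence.of_neg ih).or_left
  | negOrE₂ _ ih => exact (IsSentence.of_neg ih).or_right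
  | dnI _ ih => exact ih
  | dnE _ ih => exact ih
  | allI hA _ _ _ _ ih => exact key ih.or_left hA
  | allE c _ ih => exact ih.all_inst c
  | exI hA _ _ => exact hA
  | exE _ _ _ _ _ _ ih => exact ih
  | negAllI hA _ _ => exact hA
  | negAllE _ _ _ _ _ _ ih => exact ih
  | negExI hA _ _ _ _ => exact hA
  | negExE c _ ih => exact (IsSentence.of_neg ih).ex_inst c
  | eqI c => exact isSentence_eqn c c
  | eqE _ _ _ ih => exact ih.subst_congr _
  | pem _ hA => exact key hA hA
  | exp _ hB _ _ _ _ => exact hB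

/-- `A` is derivable in `L` from some of the formulas in `Γ`. In contrast to `Derivation`, the
set of hypotheses may be enlarged freely. -/
def Prov (L : ExtLogic) (Γ : Set (Formula S)) (A : Formula S) : Prop :=
  ∃ Γ₀ ⊆ Γ, Derivation L Γ₀ A

namespace Prov

variable {Γ Δ : Set (Formula S)} {A B C : Formula S} {x : ℕ} {c : S.Const}

theorem mono (h : Γ ⊆ Δ) : Prov L Γ A → Prov L Δ A
  | ⟨Γ₀, h₀, d⟩ => ⟨Γ₀, h₀.trans h, d⟩

theorem isSentence : Prov L Γ A → A.IsSentence
  | ⟨_, _, d⟩ => d.isSentence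

theorem hyp (hA : A.IsSentence) (h : A ∈ Γ) : Prov L Γ A :=
  ⟨{A}, Set.singleton_subset_iff.2 h, .hyp hA⟩

theorem andI : Prov L Γ A → Prov L Γ B → Prov L Γ (A.and B)
  | ⟨_, h₁, d₁⟩, ⟨_, h₂, d₂⟩ => ⟨_, Set.union_subset h₁ h₂, .andI d₁ d₂⟩

theorem andE₁ : Prov L Γ (A.and B) → Prov L Γ A
  | ⟨_, h, d⟩ => ⟨_, h, .andE₁ d⟩

theorem andE₂ : Prov L Γ (A.and B) → Prov L Γ B
  | ⟨_, h, d⟩ => ⟨_, h, .andE₂ d⟩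

theorem orI₁ (hB : B.IsSentence) : Prov L Γ A → Prov L Γ (A.or B)
  | ⟨_, h, d⟩ => ⟨_, h, .orI₁ hB d⟩

theorem orI₂ (hA : A.IsSentence) : Prov L Γ B → Prov L Γ (A.or B)
  | ⟨_, h, d⟩ => ⟨_, h, .orI₂ hA d⟩

theorem orE : Prov L Γ (A.or B) → Prov L (insert A Γ) C → Prov L (insert B Γ) C → Prov L Γ C
  | ⟨_, h, d⟩, ⟨_, h₁, d₁⟩, ⟨_, h₂, d₂⟩ =>
    ⟨_, Set.union_subset (Set.union_subset h (Set.sdiff_singleton_subset_iff.2 h₁))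
      (Set.sdiff_singleton_subset_iff.2 h₂), .orE d d₁ d₂⟩

theorem negAndI₁ (hB : B.IsSentence) : Prov L Γ A.neg → Prov L Γ (A.and B).neg
  | ⟨_, h, d⟩ => ⟨_, h, .negAndI₁ hB d⟩

theorem negAndI₂ (hA : A.IsSentence) : Prov L Γ B.neg → Prov L Γ (A.and B).neg
  | ⟨_, h, d⟩ => ⟨_, h, .negAndI₂ hA d⟩

theorem negAndE : Prov L Γ (A.and B).neg → Prov L (insert A.neg Γ) C →
    Prov L (insert B.neg Γ) C → Prov L Γ C
  | ⟨_, h, d⟩, ⟨_, h₁, d₁⟩, ⟨_, h₂, d₂⟩ =>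
    ⟨_, Set.union_subset (Set.union_subset h (Set.sdiff_singleton_subset_iff.2 h₁))
      (Set.sdiff_singleton_subset_iff.2 h₂), .negAndE d d₁ d₂⟩

theorem negOrI : Prov L Γ A.neg → Prov L Γ B.neg → Prov L Γ (A.or B).neg
  | ⟨_, h₁, d₁⟩, ⟨_, h₂, d₂⟩ => ⟨_, Set.union_subset h₁ h₂, .negOrI d₁ d₂⟩

theorem negOrE₁ : Prov L Γ (A.or B).neg → Prov L Γ A.neg
  | ⟨_, h, d⟩ => ⟨_, h, .negOrE₁ d⟩

theorem negOrE₂ : Prov L Γ (A.or B).neg → Prov L Γ B.neg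
  | ⟨_, h, d⟩ => ⟨_, h, .negOrE₂ d⟩

theorem dnI : Prov L Γ A → Prov L Γ A.neg.neg
  | ⟨_, h, d⟩ => ⟨_, h, .dnI d⟩

theorem dnE : Prov L Γ A.neg.neg → Prov L Γ A
  | ⟨_, h, d⟩ => ⟨_, h, .dnE d⟩

theorem allI (hA : (A.all x).IsSentence) (hcA : ¬ A.Occurs c) (hcB : ¬ B.Occurs c)
    (hcΓ : ∀ D ∈ Γ, ¬ D.Occurs c) : Prov L Γ (B.or (A.subst x c)) → Prov L Γ (B.or (A.all x))
  | ⟨_, h, d⟩ => ⟨_, h, .allI hA hcA hcB (fun D hD => hcΓ D (h hD)) d⟩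

theorem allE (c : S.Const) : Prov L Γ (A.all x) → Prov L Γ (A.subst x c)
  | ⟨_, h, d⟩ => ⟨_, h, .allE c d⟩

theorem exI (hA : (A.ex x).IsSentence) : Prov L Γ (A.subst x c) → Prov L Γ (A.ex x)
  | ⟨_, h, d⟩ => ⟨_, h, .exI hA d⟩

theorem exE (hcA : ¬ A.Occurs c) (hcC : ¬ C.Occurs c) (hcΓ : ∀ D ∈ Γ, ¬ D.Occurs c) :
    Prov L Γ (A.ex x) → Prov L (insert (A.subst x c) Γ) C → Prov L Γ C
  | ⟨_, h, d⟩, ⟨_, h₁, d₁⟩ =>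
    have h₁' := Set.sdiff_singleton_subset_iff.2 h₁
    ⟨_, Set.union_subset h h₁', .exE hcA hcC (fun D hD => hcΓ D (h₁' hD)) d d₁⟩

theorem negAllI (hA : (A.all x).IsSentence) :
    Prov L Γ (A.subst x c).neg → Prov L Γ (A.all x).neg
  | ⟨_, h, d⟩ => ⟨_, h, .negAllI hA d⟩

theorem negAllE (hcA : ¬ A.Occurs c) (hcC : ¬ C.Occurs c) (hcΓ : ∀ D ∈ Γ, ¬ D.Occurs c) :
    Prov L Γ (A.all x).neg → Prov L (insert (A.subst x c).neg Γ) C → Prov L Γ C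
  | ⟨_, h, d⟩, ⟨_, h₁, d₁⟩ =>
    have h₁' := Set.sdiff_singleton_subset_iff.2 h₁
    ⟨_, Set.union_subset h h₁', .negAllE hcA hcC (fun D hD => hcΓ D (h₁' hD)) d d₁⟩

theorem negExI (hA : (A.ex x).IsSentence) (hcA : ¬ A.Occurs c) (hcΓ : ∀ D ∈ Γ, ¬ D.Occurs c) :
    Prov L Γ (A.subst x c).neg → Prov L Γ (A.ex x).neg
  | ⟨_, h, d⟩ => ⟨_, h, .negExI hA hcA (fun D hD => hcΓ D (h hD)) d⟩

theorem negExE (c : S.Const) : Prov L Γ (A.ex x).neg → Prov L Γ (A.subst x c).neg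
  | ⟨_, h, d⟩ => ⟨_, h, .negExE c d⟩

theorem eqI (c : S.Const) : Prov L Γ (eqn c c) :=
  ⟨∅, Set.empty_subset _, .eqI c⟩

theorem eqE {c₁ c₂ : S.Const} :
    Prov L Γ (eqn c₁ c₂) → Prov L Γ (A.subst x c₁) → Prov L Γ (A.subst x c₂)
  | ⟨_, h₁, d₁⟩, ⟨_, h₂, d₂⟩ => ⟨_, Set.union_subset h₁ h₂, .eqE d₁ d₂⟩

theorem pem (hL : L.HasPEM) (hA : A.IsSentence) : Prov L Γ (A.or A.neg) :=
  ⟨∅, Set.empty_subset _, .pem hL hA⟩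

theorem exp (hL : L.HasEXP) (hB : B.IsSentence) : Prov L Γ A → Prov L Γ A.neg → Prov L Γ B
  | ⟨_, h₁, d₁⟩, ⟨_, h₂, d₂⟩ => ⟨_, Set.union_subset h₁ h₂, .exp hL hB d₁ d₂⟩

/-- There is no implication to discharge `A` with, but `∨E` applied to `A ∨ A` does it. -/
theorem cut (h : Prov L Γ A) (h' : Prov L (insert A Γ) B) : Prov L Γ B :=
  orE (orI₁ h.isSentence h) h' h'

/-- The form of `¬∃I` with a side disjunct, by way of `∀x¬A`. -/
theorem or_negExI (hA : (A.ex x).IsSentence) (hcA : ¬ A.Occurs c) (hcB : ¬ B.Occurs c)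
    (hcΓ : ∀ D ∈ Γ, ¬ D.Occurs c) (h : Prov L Γ (B.or (A.subst x c).neg)) :
    Prov L Γ (B.or (A.ex x).neg) := by
  have hall : (A.neg.all x).IsSentence := hA
  have hB : B.IsSentence := h.isSentence.or_left
  refine orE (allI (A := A.neg) hall hcA hcB hcΓ h) (orI₁ hA (hyp hB (Set.mem_insert _ _))) ?_
  refine orI₂ hB (mono (Γ := {A.neg.all x}) (by simp) ?_)
  refine negExI hA hcA ?_ (allE (A := A.neg) c (hyp hall rfl))
  rintro D rfl
  exact hcA

end Prov

/-- Derivations are preserved by arbitrary renamings of the constants. Where a rule has an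
eigenconstant, the renaming is first changed so as to send it to a fresh constant. -/
theorem Derivation.prov_map {C : Type w} [Infinite C] {Γ : Set (Formula S)} {A : Formula S}
    (h : Derivation L Γ A) (f : S.Const → C) : Prov L (map f '' Γ) (A.map f) := by
  classical
  -- the image of the hypotheses of a subderivation in which `A` is discharged
  have disch : ∀ {Δ Θ : Set (Formula S)} {A : Formula S} {f : S.Const → C}, Δ \ {A} ⊆ Θ →
      map f '' Δ ⊆ insert (A.map f) (map f '' Θ) := by
    rintro Δ Θ A f h _ ⟨D, hD, rfl⟩
    by_cases hDA : D = A
    · exact Or.inl (by rw [hDA])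
    · exact Or.inr ⟨D, h ⟨hD, hDA⟩, rfl⟩
  have upd : ∀ {Γ : Set (Formula S)} {c : S.Const} (f : S.Const → C) (d : C),
      (∀ D ∈ Γ, ¬ D.Occurs c) → map (Function.update f c d) '' Γ = map f '' Γ :=
    fun f d h => Set.image_congr fun D hD => map_update f d (h D hD)
  have fresh : ∀ {Γ : Set (Formula S)} (_ : Γ.Finite) (f : S.Const → C) (A B : Formula S),
      ∃ d : C, ¬ (A.map f).Occurs d ∧ ¬ (B.map f).Occurs d ∧
        ∀ D ∈ map f '' Γ, ¬ D.Occurs d := by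
    intro Γ hΓ f A B
    obtain ⟨d, hd⟩ := exists_fresh (((hΓ.image (map f)).insert (B.map f)).insert (A.map f))
    exact ⟨d, hd _ (Or.inl rfl), hd _ (Or.inr (Or.inl rfl)), fun D hD => hd D (Or.inr (Or.inr hD))⟩
  induction h generalizing f with
  | hyp hA => exact .hyp (hA.map f) ⟨_, rfl, rfl⟩
  | andI _ _ ih₁ ih₂ =>
    rw [Set.image_union]
    exact .andI ((ih₁ f).mono Set.subset_union_left) ((ih₂ f).mono Set.subset_union_right)
  | andE₁ _ ih => exact (ih f).andE₁
  | andE₂ _ ih => exact (ih f).andE₂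
  | orI₁ hB _ ih => exact (ih f).orI₁ (hB.map f)
  | orI₂ hA _ ih => exact (ih f).orI₂ (hA.map f)
  | orE _ _ _ ih ih₁ ih₂ =>
    refine .orE ((ih f).mono (Set.image_mono ?_)) ((ih₁ f).mono (disch ?_))
      ((ih₂ f).mono (disch ?_))
    · exact Set.subset_union_left.trans Set.subset_union_left
    · exact Set.subset_union_right.trans Set.subset_union_left
    · exact Set.subset_union_right
  | negAndI₁ hB _ ih => exact (ih f).negAndI₁ (hB.map f)
  | negAndI₂ hA _ ih => exact (ih f).negAndI₂ (hA.map f)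
  | negAndE _ _ _ ih ih₁ ih₂ =>
    refine .negAndE ((ih f).mono (Set.image_mono ?_)) ((ih₁ f).mono (disch (A := neg _) ?_))
      ((ih₂ f).mono (disch (A := neg _) ?_))
    · exact Set.subset_union_left.trans Set.subset_union_left
    · exact Set.subset_union_right.trans Set.subset_union_left
    · exact Set.subset_union_right
  | negOrI _ _ ih₁ ih₂ =>
    rw [Set.image_union]
    exact .negOrI ((ih₁ f).mono Set.subset_union_left) ((ih₂ f).mono Set.subset_union_right)
  | negOrE₁ _ ih => exact (ih f).negOrE₁
  | negOrE₂ _ ih => exact (ih f).negOrE₂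
  | dnI _ ih => exact (ih f).dnI
  | dnE _ ih => exact (ih f).dnE
  | @allI Γ A B x c hA hcA hcB hcΓ d ih =>
    obtain ⟨e, heA, heB, heΓ⟩ := fresh d.finite f A B
    have h := ih (Function.update f c e)
    rw [upd f e hcΓ] at h
    simp only [map, map_subst, map_update f e hcA, map_update f e hcB,
      Function.update_self] at h
    exact .allI (hA.map f) heA heB heΓ h
  | allE c _ ih => rw [map_subst]; exact (ih f).allE _
  | exI hA _ ih =>
    have h := ih f
    rw [map_subst] at h
    exact .exI (hA.map f) h
  | @exE Γ Δ A B x c hcA hcC hcΔ d d' ih ih' =>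
    obtain ⟨e, heA, heC, heΓ⟩ := fresh (d.finite.union (d'.finite.sdiff (t := {A.subst x c}))) f A B
    refine .exE heA heC heΓ ((ih f).mono (Set.image_mono Set.subset_union_left)) ?_
    have h := (ih' (Function.update f c e)).mono (disch (A := A.subst x c) subset_rfl)
    rw [upd f e hcΔ, map_update f e hcC, map_subst, map_update f e hcA,
      Function.update_self] at h
    exact h.mono (Set.insert_subset_insert (Set.image_mono Set.subset_union_right))
  | negAllI hA _ ih =>
    have h := ih f
    simp only [map, map_subst] at h
    exact .negAllI (hA.map f) h
  | @negAllE Γ Δ A B x c hcA hcC hcΔ d d' ih ih' =>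
    obtain ⟨e, heA, heC, heΓ⟩ :=
      fresh (d.finite.union (d'.finite.sdiff (t := {(A.subst x c).neg}))) f A B
    refine .negAllE heA heC heΓ ((ih f).mono (Set.image_mono Set.subset_union_left)) ?_
    have h := (ih' (Function.update f c e)).mono (disch (A := (A.subst x c).neg) subset_rfl)
    rw [upd f e hcΔ, map_update f e hcC] at h
    simp only [map, map_subst, map_update f e hcA, Function.update_self] at h
    exact h.mono (Set.insert_subset_insert (Set.image_mono Set.subset_union_right))
  | @negExI Γ A x c hA hcA hcΓ d ih =>
    obtain ⟨e, heA, -, heΓ⟩ := fresh d.finite f A A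
    have h := ih (Function.update f c e)
    rw [upd f e hcΓ] at h
    simp only [map, map_subst, map_update f e hcA, Function.update_self] at h
    exact .negExI (hA.map f) heA heΓ h
  | negExE c _ ih =>
    simp only [map, map_subst]
    exact (ih f).negExE _
  | eqI c =>
    have h : (eqn c c).map f = (eqn (f c) (f c) : Formula (S.withConst C)) := by
      simp only [eqn, map]
      congr 1
      funext i
      fin_cases i <;> rfl
    rw [h]
    exact .eqI _
  | @eqE Γ Δ A x c₁ c₂ _ _ ih₁ ih₂ =>
    have h : (eqn c₁ c₂).map f = (eqn (f c₁) (f c₂) : Formula (S.withConst C)) := by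
      simp only [eqn, map]
      congr 1
      funext i
      fin_cases i <;> rfl
    have h₁ := ih₁ f
    have h₂ := ih₂ f
    rw [h] at h₁
    rw [map_subst] at h₂ ⊢
    rw [Set.image_union]
    exact .eqE (h₁.mono Set.subset_union_left) (h₂.mono Set.subset_union_right)
  | pem hL hA => exact .pem hL (hA.map f)
  | exp hL hB _ _ ih₁ ih₂ =>
    rw [Set.image_union]
    exact .exp hL (hB.map f) ((ih₁ f).mono Set.subset_union_left)
      ((ih₂ f).mono Set.subset_union_right)

end Prov

/-! ### Soundness -/

namespace Structure

variable (𝔄 : Structure.{u, v, w} S)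

/-- Satisfaction of `A` (sign `true`) or of `¬A` (sign `false`) for formulas of the signature
itself. -/
abbrev Sat₀ (A : Formula S) (s : ℕ → 𝔄.D) (b : Bool) : Prop := 𝔄.Sat (A.toDiagram 𝔄.D) s b

theorem holds_iff_sat₀ (A : Sentence S) (s : ℕ → 𝔄.D) : 𝔄.Holds A ↔ 𝔄.Sat₀ A.val s true :=
  (𝔄.valuation_isInduced.iff_sat 𝔄 s _ _ (A.toDiagram 𝔄.D).2 rfl).1

theorem sat₀_subst (x : ℕ) (c : S.Const) (A : Formula S) (s : ℕ → 𝔄.D) (b : Bool) :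
    𝔄.Sat₀ (A.subst x c) s b ↔ 𝔄.Sat₀ A (Function.update s x (𝔄.const c)) b := by
  unfold Sat₀
  induction A generalizing s b with
  | pred P ts =>
    have h : ∀ t : Term S, 𝔄.termVal s ((t.subst x c).toDiagram 𝔄.D) =
        𝔄.termVal (Function.update s x (𝔄.const c)) (t.toDiagram 𝔄.D) := by
      intro t
      cases t with
      | var y =>
        by_cases hy : y = x
        · subst hy; simp [Term.subst, termVal, diagConst, Term.toDiagram]
        · simp [Term.subst, termVal, Term.toDiagram, hy]
      | const d => rfl
    cases b <;> simp [Formula.subst, Formula.toDiagram, Sat, h]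
  | neg A ih => simpa [Formula.subst, Formula.toDiagram, Sat] using ih s (!b)
  | and A B ihA ihB => cases b <;> simp [Formula.subst, Formula.toDiagram, Sat, ihA, ihB]
  | or A B ihA ihB => cases b <;> simp [Formula.subst, Formula.toDiagram, Sat, ihA, ihB]
  | all z A ih =>
    by_cases hz : z = x
    · subst hz; cases b <;> simp [Formula.subst, Formula.toDiagram, Sat]
    · cases b <;>
        simp [Formula.subst, Formula.toDiagram, Sat, hz, ih, Function.update_comm hz]
  | ex z A ih =>
    by_cases hz : z = x
    · subst hz; cases b <;> simp [Formula.subst, Formula.toDiagram, Sat]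
    · cases b <;>
        simp [Formula.subst, Formula.toDiagram, Sat, hz, ih, Function.update_comm hz]

open Classical in
/-- The structure that differs from `𝔄` at most in that the constant `c` denotes `a`. -/
noncomputable def reinterpret (c : S.Const) (a : 𝔄.D) : Structure.{u, v, w} S where
  D := 𝔄.D
  nonempty := 𝔄.nonempty
  const := Function.update 𝔄.const c a
  pos := 𝔄.pos
  neg := 𝔄.neg
  pos_eq := 𝔄.pos_eq

theorem reinterpret_const_self (c : S.Const) (a : 𝔄.D) : (𝔄.reinterpret c a).const c = a := by
  simp [reinterpret]

theorem sat₀_reinterpret {c : S.Const} (a : 𝔄.D) {A : Formula S} (h : ¬ A.Occurs c)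
    (s : ℕ → 𝔄.D) (b : Bool) : (𝔄.reinterpret c a).Sat₀ A s b ↔ 𝔄.Sat₀ A s b := by
  induction A generalizing s b with
  | pred P ts =>
    have h' : ∀ i, (𝔄.reinterpret c a).termVal s ((ts i).toDiagram 𝔄.D) =
        𝔄.termVal s ((ts i).toDiagram 𝔄.D) := by
      intro i
      cases hi : ts i with
      | var y => rfl
      | const d =>
        have hdc : d ≠ c := by rintro rfl; exact h ⟨i, hi⟩
        simp [Term.toDiagram, termVal, diagConst, reinterpret, hdc]
    have h'' : (fun i => (𝔄.reinterpret c a).termVal s ((ts i).toDiagram 𝔄.D)) =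
        fun i => 𝔄.termVal s ((ts i).toDiagram 𝔄.D) := funext h'
    cases b
    · exact iff_of_eq (congrArg (· ∈ 𝔄.neg P) h'')
    · exact iff_of_eq (congrArg (· ∈ 𝔄.pos P) h'')
  | neg A ih => exact ih h s (!b)
  | and A B ihA ihB =>
    have hA := ihA (fun hc => h (Or.inl hc)) s
    have hB := ihB (fun hc => h (Or.inr hc)) s
    cases b
    · exact or_congr (hA false) (hB false)
    · exact and_congr (hA true) (hB true)
  | or A B ihA ihB =>
    have hA := ihA (fun hc => h (Or.inl hc)) s
    have hB := ihB (fun hc => h (Or.inr hc)) s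
    cases b
    · exact and_congr (hA false) (hB false)
    · exact or_congr (hA true) (hB true)
  | all z A ih =>
    cases b
    · exact exists_congr fun d => ih h (Function.update s z d) false
    · exact forall_congr' fun d => ih h (Function.update s z d) true
  | ex z A ih =>
    cases b
    · exact forall_congr' fun d => ih h (Function.update s z d) false
    · exact exists_congr fun d => ih h (Function.update s z d) true

theorem sat₀_reinterpret_subst {c : S.Const} (a : 𝔄.D) {A : Formula S} (h : ¬ A.Occurs c)
    (x : ℕ) (s : ℕ → 𝔄.D) (b : Bool) :
    (𝔄.reinterpret c a).Sat₀ (A.subst x c) s b ↔ 𝔄.Sat₀ A (Function.update s x a) b := by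
  refine ((𝔄.reinterpret c a).sat₀_subst x c A s b).trans ?_
  refine (iff_of_eq (congrArg (fun d : 𝔄.D => (𝔄.reinterpret c a).Sat₀ A (Function.update s x d) b)
    (𝔄.reinterpret_const_self c a))).trans ?_
  exact 𝔄.sat₀_reinterpret a h _ b

theorem IsExhaustive.sat {𝔄 : Structure.{u, v, w} S} (h : 𝔄.IsExhaustive)
    (A : Formula (S.diagram 𝔄.D)) (s : ℕ → 𝔄.D) : 𝔄.Sat A s true ∨ 𝔄.Sat A s false := by
  induction A generalizing s with
  | pred P ts => 
    have : (fun i => 𝔄.termVal s (ts i)) ∈ 𝔄.pos P ∪ 𝔄.neg P := by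
      rw [h]
      exact Set.mem_univ _
    exact this
  | neg A ih => exact (ih s).symm
  | and A B ihA ihB => have := ihA s; have := ihB s; simp only [Sat]; tauto
  | or A B ihA ihB => have := ihA s; have := ihB s; simp only [Sat]; tauto
  | all x A ih =>
    by_cases hA : ∃ a, 𝔄.Sat A (Function.update s x a) false
    · exact Or.inr hA
    · exact Or.inl fun a => (ih _).resolve_right fun ha => hA ⟨a, ha⟩
  | ex x A ih =>
    by_cases hA : ∃ a, 𝔄.Sat A (Function.update s x a) true
    · exact Or.inl hA
    · exact Or.inr fun a => (ih _).resolve_left fun ha => hA ⟨a, ha⟩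

theorem IsExclusive.not_sat {𝔄 : Structure.{u, v, w} S} (h : 𝔄.IsExclusive)
    (A : Formula (S.diagram 𝔄.D)) (s : ℕ → 𝔄.D) : ¬ (𝔄.Sat A s true ∧ 𝔄.Sat A s false) := by
  induction A generalizing s with
  | pred P ts =>
    intro hA
    have : (fun i => 𝔄.termVal s (ts i)) ∈ 𝔄.pos P ∩ 𝔄.neg P := hA
    rw [h] at this
    exact this
  | neg A ih => exact fun hA => ih s hA.symm
  | and A B ihA ihB => have := ihA s; have := ihB s; simp only [Sat]; tauto
  | or A B ihA ihB => have := ihA s; have := ihB s; simp only [Sat]; tauto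
  | all x A ih => rintro ⟨hA, a, ha⟩; exact ih _ ⟨hA a, ha⟩
  | ex x A ih => rintro ⟨⟨a, ha⟩, hA⟩; exact ih _ ⟨ha, hA a⟩

end Structure

theorem ExtLogic.IsStructure.isExhaustive {L : ExtLogic} {𝔄 : Structure.{u, v, w} S}
    (h : L.IsStructure 𝔄) (hL : L.HasPEM) : 𝔄.IsExhaustive := by
  cases L
  exacts [h, hL.elim, h.1]

theorem ExtLogic.IsStructure.isExclusive {L : ExtLogic} {𝔄 : Structure.{u, v, w} S}
    (h : L.IsStructure 𝔄) (hL : L.HasEXP) : 𝔄.IsExclusive := by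
  cases L
  exacts [hL.elim, h, h.2]

theorem ExtLogic.IsStructure.reinterpret {L : ExtLogic} {𝔄 : Structure.{u, v, w} S}
    (h : L.IsStructure 𝔄) (c : S.Const) (a : 𝔄.D) : L.IsStructure (𝔄.reinterpret c a) := by
  cases L
  exacts [h, h, h]

/-- The rules preserve satisfaction in every structure for `L`. The structure is not fixed in the
induction, because in the rules with an eigenconstant the latter has to be reinterpreted. -/
theorem Derivation.sound {L : ExtLogic} {Γ : Set (Formula S)} {A : Formula S}
    (h : Derivation L Γ A) {𝔄 : Structure.{u, v, w} S} (h𝔄 : L.IsStructure 𝔄) (s : ℕ → 𝔄.D)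
    (hΓ : ∀ B ∈ Γ, 𝔄.Sat₀ B s true) : 𝔄.Sat₀ A s true := by
  -- the hypotheses of a subderivation hold if the discharged one and all others do
  have disch : ∀ {𝔅 : Structure.{u, v, w} S} {s : ℕ → 𝔅.D} {Δ : Set (Formula S)} {A : Formula S},
      (∀ B ∈ Δ \ {A}, 𝔅.Sat₀ B s true) → 𝔅.Sat₀ A s true → ∀ B ∈ Δ, 𝔅.Sat₀ B s true := by
    intro 𝔅 s Δ A h hA B hB
    by_cases hBA : B = A
    · exact hBA ▸ hA
    · exact h B ⟨hB, hBA⟩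
  induction h generalizing 𝔄 with
  | hyp hA => exact hΓ _ rfl
  | andI _ _ ih₁ ih₂ | negOrI _ _ ih₁ ih₂ =>
    exact ⟨ih₁ h𝔄 s fun B hB => hΓ B (Or.inl hB), ih₂ h𝔄 s fun B hB => hΓ B (Or.inr hB)⟩
  | andE₁ _ ih | negOrE₁ _ ih => exact (ih h𝔄 s hΓ).1
  | andE₂ _ ih | negOrE₂ _ ih => exact (ih h𝔄 s hΓ).2
  | orI₁ _ _ ih | negAndI₁ _ _ ih => exact Or.inl (ih h𝔄 s hΓ)
  | orI₂ _ _ ih | negAndI₂ _ _ ih => exact Or.inr (ih h𝔄 s hΓ)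
  | orE _ _ _ ih ih₁ ih₂ | negAndE _ _ _ ih ih₁ ih₂ =>
    rcases ih h𝔄 s fun B hB => hΓ B (Or.inl (Or.inl hB)) with h | h
    · exact ih₁ h𝔄 s (disch (fun B hB => hΓ B (Or.inl (Or.inr hB))) h)
    · exact ih₂ h𝔄 s (disch (fun B hB => hΓ B (Or.inr hB)) h)
  | dnI _ ih | dnE _ ih => exact ih h𝔄 s hΓ
  | @allI Γ A B x c hA hcA hcB hcΓ d ih =>
    by_cases hB : 𝔄.Sat₀ B s true
    · exact Or.inl hB
    · refine Or.inr fun a => ?_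
      have := ih (h𝔄.reinterpret c a) s
        fun D hD => (𝔄.sat₀_reinterpret a (hcΓ D hD) s true).2 (hΓ D hD)
      refine (𝔄.sat₀_reinterpret_subst a hcA x s true).1 (this.resolve_left fun h => hB ?_)
      exact (𝔄.sat₀_reinterpret a hcB s true).1 h
  | allE c _ ih => exact (𝔄.sat₀_subst _ c _ s true).2 (ih h𝔄 s hΓ _)
  | exI _ _ ih => exact ⟨_, (𝔄.sat₀_subst _ _ _ s true).1 (ih h𝔄 s hΓ)⟩
  | @exE Γ Δ A C x c hcA hcC hcΔ _ _ ih ih₁ =>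
    obtain ⟨a, ha⟩ := ih h𝔄 s fun B hB => hΓ B (Or.inl hB)
    refine (𝔄.sat₀_reinterpret a hcC s true).1
      (ih₁ (h𝔄.reinterpret c a) s (disch (A := A.subst x c) ?_ ?_))
    · exact fun D hD => (𝔄.sat₀_reinterpret a (hcΔ D hD) s true).2 (hΓ D (Or.inr hD))
    · exact (𝔄.sat₀_reinterpret_subst a hcA x s true).2 ha
  | negAllI _ _ ih => exact ⟨_, (𝔄.sat₀_subst _ _ _ s false).1 (ih h𝔄 s hΓ)⟩
  | @negAllE Γ Δ A C x c hcA hcC hcΔ _ _ ih ih₁ =>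
    obtain ⟨a, ha⟩ := ih h𝔄 s fun B hB => hΓ B (Or.inl hB)
    refine (𝔄.sat₀_reinterpret a hcC s true).1
      (ih₁ (h𝔄.reinterpret c a) s (disch (A := (A.subst x c).neg) ?_ ?_))
    · exact fun D hD => (𝔄.sat₀_reinterpret a (hcΔ D hD) s true).2 (hΓ D (Or.inr hD))
    · exact (𝔄.sat₀_reinterpret_subst a hcA x s false).2 ha
  | @negExI Γ A x c hA hcA hcΓ d ih =>
    intro a
    refine (𝔄.sat₀_reinterpret_subst a hcA x s false).1 (ih (h𝔄.reinterpret c a) s ?_)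
    exact fun D hD => (𝔄.sat₀_reinterpret a (hcΓ D hD) s true).2 (hΓ D hD)
  | negExE c _ ih => exact (𝔄.sat₀_subst _ c _ s false).2 (ih h𝔄 s hΓ _)
  | eqI c =>
    change _ ∈ 𝔄.pos Pred.eq
    rw [𝔄.pos_eq]
    rfl
  | @eqE Γ Δ A x c₁ c₂ _ _ ih₁ ih₂ =>
    have h₁ : _ ∈ 𝔄.pos Pred.eq := ih₁ h𝔄 s fun B hB => hΓ B (Or.inl hB)
    rw [𝔄.pos_eq] at h₁
    have h₁ : 𝔄.const c₁ = 𝔄.const c₂ := h₁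
    have h₂ := (𝔄.sat₀_subst _ _ _ s true).1 (ih₂ h𝔄 s fun B hB => hΓ B (Or.inr hB))
    rw [h₁] at h₂
    exact (𝔄.sat₀_subst _ _ _ s true).2 h₂
  | pem hL _ => exact (h𝔄.isExhaustive hL).sat _ s
  | exp hL _ _ _ ih₁ ih₂ =>
    exact ((h𝔄.isExclusive hL).not_sat _ s ⟨ih₁ h𝔄 s fun B hB => hΓ B (Or.inl hB),
      ih₂ h𝔄 s fun B hB => hΓ B (Or.inr hB)⟩).elim

theorem Provable.consequence {L : ExtLogic} {Γ : Set (Sentence S)} {A : Sentence S}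
    (h : Provable L Γ A) : Consequence.{u, v, w} L Γ A := by
  obtain ⟨Γ₀, hΓ₀, d⟩ := h
  intro 𝔄 h𝔄 hΓ
  obtain ⟨a⟩ := 𝔄.nonempty
  refine (𝔄.holds_iff_sat₀ A fun _ => a).2 (d.sound h𝔄 _ fun B hB => ?_)
  obtain ⟨B, hBΓ, rfl⟩ := hΓ₀ hB
  exact (𝔄.holds_iff_sat₀ B _).1 (hΓ B hBΓ)

/-! ### Prime theories -/

section Prime

open Formula

variable {L : ExtLogic}

/-- A prime theory of `L`: a set of sentences that is closed under derivability and contains a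
disjunct of each disjunction in it. -/
structure IsPrimeTheory (L : ExtLogic) (T : Set (Formula S)) : Prop where
  isSentence : ∀ A ∈ T, A.IsSentence
  closed : ∀ {A : Formula S}, Prov L T A → A ∈ T
  prime : ∀ {A B : Formula S}, A.or B ∈ T → A ∈ T ∨ B ∈ T

theorem IsPrimeTheory.prov {T : Set (Formula S)} (hT : IsPrimeTheory L T) {A : Formula S}
    (hA : A ∈ T) : Prov L T A :=
  .hyp (hT.isSentence A hA) hA

theorem exists_isPrimeTheory {Γ : Set (Formula S)} {D : Formula S}
    (hΓ : ∀ A ∈ Γ, A.IsSentence) (hD : D.IsSentence) (h : ¬ Prov L Γ D) :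
    ∃ T, Γ ⊆ T ∧ IsPrimeTheory L T ∧ D ∉ T := by
  obtain ⟨T, hΓT, hT⟩ := zorn_subset_nonempty
    {T : Set (Formula S) | (∀ A ∈ T, A.IsSentence) ∧ ¬ Prov L T D} (by
      intro c hc hchain hne
      refine ⟨⋃₀ c, ⟨fun A ⟨t, ht, hA⟩ => (hc ht).1 A hA, ?_⟩,
        fun t ht => Set.subset_sUnion_of_mem ht⟩
      rintro ⟨Γ₀, h₀, d⟩
      obtain ⟨t, ht, h₀t⟩ :=
        hchain.directedOn.exists_mem_subset_of_finite_of_subset_sUnion hne d.finite h₀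
      exact (hc ht).2 ⟨Γ₀, h₀t, d⟩) Γ ⟨hΓ, h⟩
  have max : ∀ A : Formula S, A.IsSentence → A ∉ T → Prov L (insert A T) D := by
    intro A hA hAT
    by_contra hn
    refine hAT (hT.le_of_ge (y := insert A T) ⟨?_, hn⟩ (Set.subset_insert A T)
      (Set.mem_insert A T))
    rintro B (rfl | hB)
    exacts [hA, hT.prop.1 B hB]
  refine ⟨T, hΓT, ⟨hT.prop.1, ?_, ?_⟩, fun hDT => hT.prop.2 (.hyp hD hDT)⟩
  · intro A hA
    by_contra hAT
    exact hT.prop.2 (hA.cut (max A hA.isSentence hAT))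
  · intro A B hAB
    have hs := hT.prop.1 _ hAB
    by_contra! hn
    exact hT.prop.2 (.orE (.hyp hs hAB) (max A hs.and_left hn.1) (max B hs.and_right hn.2))

/-! ### Witnesses -/

/-- The constant `c` decides the quantified formula for the theory `T`: it is an example if
`∃xA` or `¬∀xA` belongs to `T`, and a counterexample if `∀xA` or `¬∃xA` does not. -/
def Witnesses (T : Set (Formula S)) (c : S.Const) : Formula S → Prop
  | .ex x A => A.ex x ∈ T → A.subst x c ∈ T
  | .all x A => A.subst x c ∈ T → A.all x ∈ T
  | .neg (.all x A) => (A.all x).neg ∈ T → (A.subst x c).neg ∈ T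
  | .neg (.ex x A) => (A.subst x c).neg ∈ T → (A.ex x).neg ∈ T
  | _ => True

/-- All constants that occur in `A` belong to `K`. -/
def ConstsIn (K : Set S.Const) (A : Formula S) : Prop := ∀ c, A.Occurs c → c ∈ K

theorem ConstsIn.mono {K K' : Set S.Const} (h : K ⊆ K') {A : Formula S} (hA : ConstsIn K A) :
    ConstsIn K' A := fun c hc => h (hA c hc)

theorem ConstsIn.subst {K : Set S.Const} {x : ℕ} {A : Formula S} {c : S.Const}
    (hA : ConstsIn K A) : ConstsIn (insert c K) (A.subst x c) :=
  fun _ hd => hd.of_subst.imp_right (hA _)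

theorem ConstsIn.or {K : Set S.Const} {A B : Formula S} (hA : ConstsIn K A) (hB : ConstsIn K B) :
    ConstsIn K (A.or B) := fun c hc => hc.elim (hA c) (hB c)

/-- `D` is not derivable from `Γ`, all formulas involved are sentences, and all constants in them
belong to `K`. Such a pair `(Γ, D)` describes the prime theories that include `Γ` and omit `D`.
Since disjunctions are available, a single sentence `D` suffices on the right. -/
structure Separable (L : ExtLogic) (K : Set S.Const) (Γ : Set (Formula S)) (D : Formula S) :
    Prop where
  isSentence : ∀ A ∈ Γ, A.IsSentence
  isSentence' : D.IsSentence
  constsIn : ∀ A ∈ Γ, ConstsIn K A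
  constsIn' : ConstsIn K D
  not_prov : ¬ Prov L Γ D

theorem Separable.insert_left {K : Set S.Const} {Γ : Set (Formula S)} {D A : Formula S} {c : S.Const}
    (h : Separable L K Γ D) (hA : A.IsSentence) (hAK : ConstsIn (insert c K) A)
    (hn : ¬ Prov L (insert A Γ) D) : Separable L (insert c K) (insert A Γ) D where
  isSentence := by rintro B (rfl | hB); exacts [hA, h.isSentence B hB]
  isSentence' := h.isSentence'
  constsIn := by
    rintro B (rfl | hB)
    exacts [hAK, (h.constsIn B hB).mono (Set.subset_insert c K)]
  constsIn' := h.constsIn'.mono (Set.subset_insert c K)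
  not_prov := hn

theorem Separable.or_right {K : Set S.Const} {Γ : Set (Formula S)} {D A : Formula S} {c : S.Const}
    (h : Separable L K Γ D) (hA : A.IsSentence) (hAK : ConstsIn (insert c K) A)
    (hn : ¬ Prov L Γ (D.or A)) : Separable L (insert c K) Γ (D.or A) where
  isSentence := h.isSentence
  isSentence' := ⟨⟨h.isSentence'.1, hA.1⟩, fun x hx => hx.elim (h.isSentence'.2 x) (hA.2 x)⟩
  constsIn := fun B hB => (h.constsIn B hB).mono (Set.subset_insert c K)
  constsIn' := (h.constsIn'.mono (Set.subset_insert c K)).or hAK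
  not_prov := hn

theorem Separable.mono {K K' : Set S.Const} {Γ : Set (Formula S)} {D : Formula S}
    (h : Separable L K Γ D) (hK : K ⊆ K') : Separable L K' Γ D where
  isSentence := h.isSentence
  isSentence' := h.isSentence'
  constsIn := fun B hB => (h.constsIn B hB).mono hK
  constsIn' := h.constsIn'.mono hK
  not_prov := h.not_prov

theorem IsPrimeTheory.notMem_of_or {T : Set (Formula S)} (hT : IsPrimeTheory L T)
    {D A : Formula S} (hA : A.IsSentence) (h : D.or A ∉ T) : D ∉ T :=
  fun hD => h (hT.closed ((hT.prov hD).orI₁ hA))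

theorem IsPrimeTheory.notMem_of_or' {T : Set (Formula S)} (hT : IsPrimeTheory L T)
    {D A : Formula S} (hD : D.IsSentence) (h : D.or A ∉ T) : A ∉ T :=
  fun hA => h (hT.closed ((hT.prov hA).orI₂ hD))

/-- A separable pair can be strengthened so that a fresh constant becomes a witness for a given
sentence, in every prime theory that the stronger pair allows. An example is added to the left
component, and a counterexample is added to the right one as a disjunct. -/
theorem Separable.exists_witnesses {K : Set S.Const} {Γ : Set (Formula S)} {D : Formula S}
    (h : Separable L K Γ D) {c : S.Const} (hc : c ∉ K) {F : Formula S} (hF : F.IsSentence)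
    (hFK : ConstsIn K F) :
    ∃ Γ' D', Separable L (insert c K) Γ' D' ∧ Γ ⊆ Γ' ∧
      ∀ T, IsPrimeTheory L T → Γ' ⊆ T → D' ∉ T → D ∉ T ∧ Witnesses T c F := by
  have hcF : ¬ F.Occurs c := fun ho => hc (hFK c ho)
  have hcD : ¬ D.Occurs c := fun ho => hc (h.constsIn' c ho)
  have hcΓ : ∀ A ∈ Γ, ¬ A.Occurs c := fun A hA ho => hc (h.constsIn A hA c ho)
  have hK := Set.subset_insert c K
  -- `X` is the sentence to be exemplified by `Y`; if `D` is derivable from `X`, nothing has to be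
  -- done, because a theory that omits `D` then omits `X`
  have pos : ∀ X Y : Formula S, Y.IsSentence → ConstsIn (insert c K) Y →
      (Prov L (insert X Γ) X → Prov L (insert Y (insert X Γ)) D →
        Prov L (insert X Γ) D) → X.IsSentence → ∃ Γ', Separable L (insert c K) Γ' D ∧
          Γ ⊆ Γ' ∧ ∀ T, IsPrimeTheory L T → Γ' ⊆ T → D ∉ T → X ∈ T → Y ∈ T := by
    intro X Y hY hYK hXY hX
    by_cases hp : Prov L (insert X Γ) D
    · exact ⟨Γ, h.mono hK, subset_rfl, fun T hT hΓ hD hXT =>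
        (hD (hT.closed (hp.mono (Set.insert_subset hXT hΓ)))).elim⟩
    · refine ⟨insert Y Γ, h.insert_left hY hYK fun hn => hp ?_, Set.subset_insert _ _,
        fun T _ hΓ _ _ => hΓ (Set.mem_insert _ _)⟩
      exact hXY (.hyp hX (Set.mem_insert _ _))
        (hn.mono (Set.insert_subset_insert (Set.subset_insert _ _)))
  -- `X` is the sentence to be refuted by `Y`; if `D ∨ Y` is derivable, so is `D ∨ X`, and a prime
  -- theory that omits `D` contains `X`
  have neg : ∀ X Y : Formula S, Y.IsSentence → ConstsIn (insert c K) Y →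
      (Prov L Γ (D.or Y) → Prov L Γ (D.or X)) → ∃ D', Separable L (insert c K) Γ D' ∧
          ∀ T, IsPrimeTheory L T → Γ ⊆ T → D' ∉ T → D ∉ T ∧ (Y ∈ T → X ∈ T) := by
    intro X Y hY hYK hXY
    by_cases hp : Prov L Γ (D.or Y)
    · exact ⟨D, h.mono hK, fun T hT hΓ hD =>
        ⟨hD, fun _ => (hT.prime (hT.closed ((hXY hp).mono hΓ))).resolve_left hD⟩⟩
    · exact ⟨D.or Y, h.or_right hY hYK hp, fun T hT _ hD =>
        ⟨hT.notMem_of_or hY hD, fun hYT => (hT.notMem_of_or' h.isSentence' hD hYT).elim⟩⟩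
  have fresh : ∀ X : Formula S, ¬ X.Occurs c → ∀ A ∈ insert X Γ, ¬ A.Occurs c := by
    rintro X hX A (rfl | hA)
    exacts [hX, hcΓ A hA]
  have triv : (∀ T : Set (Formula S), Witnesses T c F) → ∃ Γ' D',
      Separable L (insert c K) Γ' D' ∧ Γ ⊆ Γ' ∧
      ∀ T, IsPrimeTheory L T → Γ' ⊆ T → D' ∉ T → D ∉ T ∧ Witnesses T c F :=
    fun hw => ⟨Γ, D, h.mono hK, subset_rfl, fun T _ _ hD => ⟨hD, hw T⟩⟩
  match F, hF, hFK, hcF, triv with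
  | .ex x A, hF, hFK, hcF, _ =>
    obtain ⟨Γ', h₁, h₂, h₃⟩ := pos (A.ex x) (A.subst x c) (hF.ex_inst c)
      (ConstsIn.subst (A := A) hFK) (fun p q => .exE (A := A) hcF hcD (fresh _ hcF) p q) hF
    exact ⟨Γ', D, h₁, h₂, fun T hT hΓ hD => ⟨hD, h₃ T hT hΓ hD⟩⟩
  | .neg (.all x A), hF, hFK, hcF, _ =>
    obtain ⟨Γ', h₁, h₂, h₃⟩ := pos (A.all x).neg (A.subst x c).neg
      (IsSentence.all_inst (A := A) hF c).neg
      (ConstsIn.subst (A := A) hFK) (fun p q => .negAllE (A := A) hcF hcD (fresh _ hcF) p q) hF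
    exact ⟨Γ', D, h₁, h₂, fun T hT hΓ hD => ⟨hD, h₃ T hT hΓ hD⟩⟩
  | .all x A, hF, hFK, hcF, _ =>
    obtain ⟨D', h₁, h₂⟩ := neg (A.all x) (A.subst x c) (hF.all_inst c)
      (ConstsIn.subst (A := A) hFK) (fun p => .allI hF hcF hcD hcΓ p)
    exact ⟨Γ, D', h₁, subset_rfl, h₂⟩
  | .neg (.ex x A), hF, hFK, hcF, _ =>
    obtain ⟨D', h₁, h₂⟩ := neg (A.ex x).neg (A.subst x c).neg
      (IsSentence.ex_inst (A := A) hF c).neg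
      (ConstsIn.subst (A := A) hFK) (fun p => .or_negExI hF hcF hcD hcΓ p)
    exact ⟨Γ, D', h₁, subset_rfl, h₂⟩
  | .pred _ _, _, _, _, triv | .and _ _, _, _, _, triv | .or _ _, _, _, _, triv
  | .neg (.pred _ _), _, _, _, triv | .neg (.neg _), _, _, _, triv
  | .neg (.and _ _), _, _, _, triv | .neg (.or _ _), _, _, _, triv =>
    exact triv fun _ => trivial

end Prime

/-! ### Formulas as constants -/

/-- The constants of the Henkin language: the constants of `S`, and the codes of all formulas of
the Henkin language itself, under which a quantified formula is its own witness. Terms are coded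
along with formulas; `term c` is the code of the constant `c` as a term. -/
inductive HenkinConst (S : Signature.{u, v}) : Type (max u v)
  | base (c : S.Const)
  | var (x : ℕ)
  | term (c : HenkinConst S)
  | pred {n : ℕ} (P : S.Pred n) (ts : Fin n → HenkinConst S)
  | neg (a : HenkinConst S)
  | and (a b : HenkinConst S)
  | or (a b : HenkinConst S)
  | all (x : ℕ) (a : HenkinConst S)
  | ex (x : ℕ) (a : HenkinConst S)

instance : Infinite (HenkinConst S) :=
  have := S.infinite_const
  Infinite.of_injective HenkinConst.base fun _ _ => HenkinConst.base.inj

/-- The signature of the Henkin language. -/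
abbrev Signature.henkin (S : Signature.{u, v}) : Signature.{max u v, v} :=
  S.withConst (HenkinConst S)

namespace HenkinConst

/-- The depth of a constant as a tree. -/
def depth : HenkinConst S → ℕ
  | .base _ => 0
  | .var _ => 0
  | .term c => depth c + 1
  | .pred _ ts => (Finset.univ.sup fun i => depth (ts i)) + 1
  | .neg a => depth a + 1
  | .and a b => max (depth a) (depth b) + 1
  | .or a b => max (depth a) (depth b) + 1
  | .all _ a => depth a + 1
  | .ex _ a => depth a + 1

end HenkinConst

/-- The code of a term of the Henkin language. -/
def Term.code : Term S.henkin → HenkinConst S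
  | .var x => .var x
  | .const c => .term c

namespace Formula

/-- The code of a formula of the Henkin language. -/
def code : Formula S.henkin → HenkinConst S
  | .pred P ts => .pred P fun i => (ts i).code
  | .neg A => .neg (code A)
  | .and A B => .and (code A) (code B)
  | .or A B => .or (code A) (code B)
  | .all x A => .all x (code A)
  | .ex x A => .ex x (code A)

theorem code_ne_base (A : Formula S.henkin) (c : S.Const) : A.code ≠ .base c := by
  cases A <;> simp [code]

theorem code_injective : Function.Injective (code (S := S)) := by
  intro A
  induction A with
  | pred P ts =>
    intro B h
    cases B with
    | pred Q us =>
      simp only [code, HenkinConst.pred.injEq] at h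
      obtain ⟨rfl, h, h'⟩ := h
      obtain rfl := eq_of_heq h
      congr 1
      funext i
      have hi := congrFun (eq_of_heq h') i
      cases ht : ts i <;> cases hu : us i <;> simp_all [Term.code]
    | _ => simp [code] at h
  | neg A ih =>
    intro B h
    cases B with
    | neg B => rw [ih (HenkinConst.neg.inj h)]
    | _ => simp [code] at h
  | and A A' ih ih' =>
    intro B h
    cases B with
    | and B B' => rw [ih (HenkinConst.and.inj h).1, ih' (HenkinConst.and.inj h).2]
    | _ => simp [code] at h
  | or A A' ih ih' =>
    intro B h
    cases B with
    | or B B' => rw [ih (HenkinConst.or.inj h).1, ih' (HenkinConst.or.inj h).2]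
    | _ => simp [code] at h
  | all x A ih =>
    intro B h
    cases B with
    | all y B => rw [ih (HenkinConst.all.inj h).2, (HenkinConst.all.inj h).1]
    | _ => simp [code] at h
  | ex x A ih =>
    intro B h
    cases B with
    | ex y B => rw [ih (HenkinConst.ex.inj h).2, (HenkinConst.ex.inj h).1]
    | _ => simp [code] at h

theorem Occurs.depth_lt {c : HenkinConst S} {A : Formula S.henkin} (h : A.Occurs c) :
    c.depth < A.code.depth := by
  induction A with
  | pred P ts =>
    obtain ⟨i, hi⟩ := h
    have h₁ := Finset.le_sup (f := fun i => (ts i).code.depth) (Finset.mem_univ i)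
    rw [show (ts i).code.depth = c.depth + 1 by rw [hi]; rfl] at h₁
    exact h₁.trans (Nat.le_succ _)
  | neg A ih => exact (ih h).trans (Nat.lt_succ_self _)
  | and A B ihA ihB =>
    simp only [code, HenkinConst.depth]
    rcases h with h | h
    · have := ihA h; omega
    · have := ihB h; omega
  | or A B ihA ihB =>
    simp only [code, HenkinConst.depth]
    rcases h with h | h
    · have := ihA h; omega
    · have := ihB h; omega
  | all z A ih => exact (ih h).trans (Nat.lt_succ_self _)
  | ex z A ih => exact (ih h).trans (Nat.lt_succ_self _)

end Formula

/-! ### Henkin theories -/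

section Henkin

open Formula

variable {L : ExtLogic}

/-- The sentences are treated in the order of the depth of their codes. The code of a sentence is
then fresh when its turn comes: constants that occur in earlier sentences have smaller depth, and
codes of earlier sentences are different. -/
theorem Separable.exists_forall_witnesses {Γ : Set (Formula S.henkin)} {D : Formula S.henkin}
    (h : Separable L (Set.range HenkinConst.base) Γ D) (𝓕 : Finset (Formula S.henkin)) :
    ∃ T, IsPrimeTheory L T ∧ Γ ⊆ T ∧ D ∉ T ∧
      ∀ F ∈ 𝓕, F.IsSentence → Witnesses T F.code F := by
  classical
  obtain ⟨Γ', D', h', hΓ, hw⟩ : ∃ Γ' D',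
      Separable L (Set.range HenkinConst.base ∪
        {c | ∃ F ∈ 𝓕, c = F.code ∨ F.Occurs c}) Γ' D' ∧ Γ ⊆ Γ' ∧
      ∀ T, IsPrimeTheory L T → Γ' ⊆ T → D' ∉ T → D ∉ T ∧
        ∀ F ∈ 𝓕, F.IsSentence → Witnesses T F.code F := by
    induction 𝓕 using Finset.induction_on_max_value (fun F : Formula S.henkin => F.code.depth) with
    | empty =>
      exact ⟨Γ, D, h.mono Set.subset_union_left, subset_rfl, fun T _ _ hD => ⟨hD, by simp⟩⟩
    | insert G 𝓕 hG hmax ih =>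
      obtain ⟨Γ', D', h', hΓ, hw⟩ := ih
      have hsub : Set.range HenkinConst.base ∪ {c | ∃ F ∈ 𝓕, c = F.code ∨ F.Occurs c} ⊆
          Set.range HenkinConst.base ∪ {c | ∃ F ∈ insert G 𝓕, c = F.code ∨ F.Occurs c} :=
        Set.union_subset_union_right _ fun c ⟨F, hF, hc⟩ => ⟨F, Finset.mem_insert_of_mem hF, hc⟩
      by_cases hGs : G.IsSentence
      · have hc : G.code ∉ Set.range HenkinConst.base ∪
            {c | ∃ F ∈ 𝓕, c = F.code ∨ F.Occurs c} ∪ {c | G.Occurs c} := by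
          rintro ((⟨c, hc⟩ | ⟨F, hF, hc | hc⟩) | hc)
          · exact code_ne_base G c hc.symm
          · exact hG (code_injective hc ▸ hF)
          · exact absurd hc.depth_lt (not_lt.2 (hmax F hF))
          · exact lt_irrefl _ (Occurs.depth_lt hc)
        obtain ⟨Γ'', D'', h'', hΓ', hw'⟩ :=
          (h'.mono Set.subset_union_left).exists_witnesses hc hGs
            (fun c hc => Or.inr hc)
        refine ⟨Γ'', D'', h''.mono ?_, hΓ.trans hΓ', fun T hT hΓT hDT => ?_⟩
        · rintro c (rfl | hc | hc)
          · exact Or.inr ⟨G, Finset.mem_insert_self _ _, Or.inl rfl⟩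
          · exact hsub hc
          · exact Or.inr ⟨G, Finset.mem_insert_self _ _, Or.inr hc⟩
        · obtain ⟨h₁, h₂⟩ := hw' T hT hΓT hDT
          obtain ⟨h₃, h₄⟩ := hw T hT (hΓ'.trans hΓT) h₁
          refine ⟨h₃, fun F hF hFs => ?_⟩
          rcases Finset.mem_insert.1 hF with rfl | hF
          exacts [h₂, h₄ F hF hFs]
      · refine ⟨Γ', D', h'.mono hsub, hΓ, fun T hT hΓT hDT => ?_⟩
        obtain ⟨h₃, h₄⟩ := hw T hT hΓT hDT
        refine ⟨h₃, fun F hF hFs => ?_⟩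
        rcases Finset.mem_insert.1 hF with rfl | hF
        exacts [(hGs hFs).elim, h₄ F hF hFs]
  obtain ⟨T, hΓT, hT, hDT⟩ := exists_isPrimeTheory h'.isSentence h'.isSentence' h'.not_prov
  exact ⟨T, hT, hΓ.trans hΓT, hw T hT hΓT hDT⟩

/-- An ultraproduct argument: the theories that have witnesses for the members of a finite set
converge along an ultrafilter to a theory that has witnesses for all sentences. -/
theorem Separable.exists_henkinTheory {Γ : Set (Formula S.henkin)} {D : Formula S.henkin}
    (h : Separable L (Set.range HenkinConst.base) Γ D) :
    ∃ T, IsPrimeTheory L T ∧ Γ ⊆ T ∧ D ∉ T ∧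
      ∀ F : Formula S.henkin, F.IsSentence → Witnesses T F.code F := by
  choose T hT hΓ hD hw using h.exists_forall_witnesses
  let U : Ultrafilter (Finset (Formula S.henkin)) := Ultrafilter.of Filter.atTop
  have hU : (U : Filter (Finset (Formula S.henkin))) ≤ Filter.atTop := Ultrafilter.of_le _
  refine ⟨{A | ∀ᶠ 𝓕 in (U : Filter _), A ∈ T 𝓕}, ⟨?_, ?_, ?_⟩, ?_, ?_, ?_⟩
  · intro A hA
    obtain ⟨𝓕, h𝓕⟩ := hA.exists
    exact (hT 𝓕).isSentence A h𝓕
  · rintro A ⟨Γ₀, h₀, d⟩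
    have h₀ : ∀ᶠ 𝓕 in (U : Filter _), ∀ B ∈ Γ₀, B ∈ T 𝓕 :=
      (Filter.eventually_all_finite d.finite).2 h₀
    exact h₀.mono fun 𝓕 h => (hT 𝓕).closed ⟨Γ₀, h, d⟩
  · intro A B hAB
    exact Ultrafilter.eventually_or.1 (hAB.mono fun 𝓕 h => (hT 𝓕).prime h)
  · exact fun A hA => .of_forall fun 𝓕 => hΓ 𝓕 hA
  · intro hA
    obtain ⟨𝓕, h𝓕⟩ := hA.exists
    exact hD 𝓕 h𝓕
  · intro F hF
    have hev : ∀ᶠ 𝓕 in (U : Filter _), Witnesses (T 𝓕) F.code F :=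
      hU ((Filter.eventually_ge_atTop {F}).mono fun 𝓕 h𝓕 =>
        hw 𝓕 F (h𝓕 (Finset.mem_singleton_self F)) hF)
    have trans : ∀ {A B : Formula S.henkin}, (∀ᶠ 𝓕 in (U : Filter _), A ∈ T 𝓕 → B ∈ T 𝓕) →
        (∀ᶠ 𝓕 in (U : Filter _), A ∈ T 𝓕) → ∀ᶠ 𝓕 in (U : Filter _), B ∈ T 𝓕 :=
      fun h hA => h.mp (hA.mono fun _ h h' => h' h)
    match F, hev with
    | .ex x A, hev => exact trans hev
    | .all x A, hev => exact trans hev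
    | .neg (.all x A), hev => exact trans hev
    | .neg (.ex x A), hev => exact trans hev
    | .pred _ _, _ | .and _ _, _ | .or _ _, _
    | .neg (.pred _ _), _ | .neg (.neg _), _ | .neg (.and _ _), _ | .neg (.or _ _), _ => trivial

end Henkin

/-! ### The canonical structure -/

section Canonical

open Formula

variable {L : ExtLogic}

namespace IsPrimeTheory

variable {T : Set (Formula S)} {A B : Formula S} {x : ℕ}

theorem and_mem (hT : IsPrimeTheory L T) : A.and B ∈ T ↔ A ∈ T ∧ B ∈ T :=
  ⟨fun h => ⟨hT.closed (hT.prov h).andE₁, hT.closed (hT.prov h).andE₂⟩,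
    fun h => hT.closed ((hT.prov h.1).andI (hT.prov h.2))⟩

theorem or_mem (hT : IsPrimeTheory L T) (hs : (A.or B).IsSentence) :
    A.or B ∈ T ↔ A ∈ T ∨ B ∈ T :=
  ⟨hT.prime, fun h => h.elim (fun h => hT.closed ((hT.prov h).orI₁ hs.or_right))
    fun h => hT.closed ((hT.prov h).orI₂ hs.or_left)⟩

theorem neg_and_mem (hT : IsPrimeTheory L T) (hs : (A.and B).IsSentence) :
    (A.and B).neg ∈ T ↔ A.neg ∈ T ∨ B.neg ∈ T := by
  have hA := hs.and_left.neg
  have hB := hs.and_right.neg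
  refine ⟨fun h => hT.prime (hT.closed ((hT.prov h).negAndE ?_ ?_)), fun h => h.elim
    (fun h => hT.closed ((hT.prov h).negAndI₁ hs.and_right))
    fun h => hT.closed ((hT.prov h).negAndI₂ hs.and_left)⟩
  · exact .orI₁ hB (.hyp hA (Set.mem_insert _ _))
  · exact .orI₂ hA (.hyp hB (Set.mem_insert _ _))

theorem neg_or_mem (hT : IsPrimeTheory L T) : (A.or B).neg ∈ T ↔ A.neg ∈ T ∧ B.neg ∈ T :=
  ⟨fun h => ⟨hT.closed (hT.prov h).negOrE₁, hT.closed (hT.prov h).negOrE₂⟩,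
    fun h => hT.closed ((hT.prov h.1).negOrI (hT.prov h.2))⟩

theorem neg_neg_mem (hT : IsPrimeTheory L T) : A.neg.neg ∈ T ↔ A ∈ T :=
  ⟨fun h => hT.closed (hT.prov h).dnE, fun h => hT.closed (hT.prov h).dnI⟩

theorem eqE (hT : IsPrimeTheory L T) {c d : S.Const} (h : eqn c d ∈ T) (hA : A.subst x c ∈ T) :
    A.subst x d ∈ T :=
  hT.closed ((hT.prov h).eqE (hT.prov hA))

/-- Identity according to a prime theory. -/
def setoid (hT : IsPrimeTheory L T) : Setoid S.Const where
  r c d := eqn c d ∈ T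
  iseqv := by
    have left : ∀ c d : S.Const,
        (Formula.pred Pred.eq ![.var 0, .const d] : Formula S).subst 0 c = eqn c d := by
      intro c d
      simp only [subst, eqn]
      congr 1
      funext i
      fin_cases i <;> rfl
    have right : ∀ c d : S.Const,
        (Formula.pred Pred.eq ![.const c, .var 0] : Formula S).subst 0 d = eqn c d := by
      intro c d
      simp only [subst, eqn]
      congr 1
      funext i
      fin_cases i <;> rfl
    have refl : ∀ c, eqn c c ∈ T := fun c => hT.closed (.eqI c)
    refine ⟨refl, fun {c d} h => ?_, fun {c d e} h h' => ?_⟩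
    · rw [← left]
      exact hT.eqE h (by rw [left]; exact refl c)
    · rw [← right]
      exact hT.eqE h' (by rw [right]; exact h)

/-- Replacement of all arguments of an atom by equal ones; with `f` the identity or negation, this
covers both literals. -/
theorem congr_pred (hT : IsPrimeTheory L T) {n : ℕ} {P : S.Pred n} {c d : Fin n → S.Const}
    (hcd : ∀ i, eqn (c i) (d i) ∈ T) (f : Formula S → Formula S)
    (hf : ∀ (x : ℕ) (e : S.Const) (A : Formula S), (f A).subst x e = f (A.subst x e))
    (h : f (.pred P fun i => .const (c i)) ∈ T) : f (.pred P fun i => .const (d i)) ∈ T := by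
  suffices H : ∀ s : Finset (Fin n),
      f (.pred P fun i => .const (if i ∈ s then d i else c i)) ∈ T by
    simpa using H Finset.univ
  intro s
  induction s using Finset.induction_on with
  | empty => simpa using h
  | insert k s hk ih =>
    -- the atom with the variable `v₀` in place of its `k`-th argument
    let A : Formula S := .pred P fun i =>
      if i = k then .var 0 else .const (if i ∈ s then d i else c i)
    have hc : A.subst 0 (c k) = .pred P fun i => .const (if i ∈ s then d i else c i) := by
      simp only [A, subst]
      congr 1
      funext i
      by_cases hi : i = k
      · subst hi; simp [Term.subst, hk]
      · simp [Term.subst, hi]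
    have hd : A.subst 0 (d k) =
        .pred P fun i => .const (if i ∈ insert k s then d i else c i) := by
      simp only [A, subst]
      congr 1
      funext i
      by_cases hi : i = k
      · subst hi; simp [Term.subst]
      · simp [Term.subst, hi]
    rw [← hd, ← hf]
    exact hT.eqE (hcd k) (by rw [hf, hc]; exact ih)

end IsPrimeTheory

section

variable {T : Set (Formula S.henkin)}

/-- The canonical structure of a prime theory in the Henkin language. Its elements are the classes
of constants that the theory identifies, lifted to the required universe. An atom is evaluated at
chosen representatives of the classes. -/
noncomputable def IsPrimeTheory.canonicalStructure (hT : IsPrimeTheory L T) :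
    Structure.{u, v, max u v w} S where
  D := ULift.{w} (Quotient hT.setoid)
  nonempty :=
    have := S.infinite_const
    ⟨⟨Quotient.mk _ (.base (Classical.arbitrary S.Const))⟩⟩
  const c := ⟨Quotient.mk _ (.base c)⟩
  pos P := {a | .pred P (fun i => .const (a i).down.out) ∈ T}
  neg P := {a | .neg (.pred P fun i => .const (a i).down.out) ∈ T}
  pos_eq := by
    ext a
    have h : (.pred Pred.eq fun i => .const (a i).down.out : Formula S.henkin) =
        eqn (a 0).down.out (a 1).down.out := by
      simp only [eqn]
      congr 1
      funext i
      fin_cases i <;> rfl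
    refine (iff_of_eq (congrArg (· ∈ T) h)).trans ?_
    exact (Quotient.out_equiv_out (s := hT.setoid)).trans ULift.down_inj

/-- The constant that names an object of the diagram language of the canonical structure. -/
noncomputable def IsPrimeTheory.name (hT : IsPrimeTheory L T) :
    S.Const ⊕ (canonicalStructure.{u, v, w} hT).D → HenkinConst S :=
  Sum.elim .base fun a => a.down.out

theorem IsPrimeTheory.eqn_name (hT : IsPrimeTheory L T)
    (c : S.Const ⊕ (canonicalStructure.{u, v, w} hT).D) :
    (eqn (hT.name c) ((canonicalStructure.{u, v, w} hT).diagConst c).down.out :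
      Formula S.henkin) ∈ T := by
  cases c with
  | inl c => exact hT.setoid.symm (Quotient.mk_out (s := hT.setoid) (HenkinConst.base c))
  | inr a => exact hT.setoid.refl _

/-- The translation from the diagram language of the canonical structure to the Henkin language. -/
noncomputable def IsPrimeTheory.translate (hT : IsPrimeTheory L T)
    (A : Formula (S.diagram (canonicalStructure.{u, v, w} hT).D)) : Formula S.henkin :=
  map (S := S.diagram (canonicalStructure.{u, v, w} hT).D) hT.name A

/-- A sentence of the diagram language is true in the canonical structure if and only if its
translation to the Henkin language belongs to the theory. -/
theorem IsPrimeTheory.isInducedValuation (hT : IsPrimeTheory L T)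
    (hw : ∀ F : Formula S.henkin, F.IsSentence → Witnesses T F.code F) [DecidablePred (· ∈ T)] :
    (canonicalStructure.{u, v, w} hT).IsInducedValuation fun A =>
      decide (hT.translate A.val ∈ T) := by
  have symm : ∀ {c d : HenkinConst S}, (eqn c d : Formula S.henkin) ∈ T → eqn d c ∈ T :=
    fun h => hT.setoid.symm h
  -- each constant is equal to the name of an element
  have rep : ∀ c : HenkinConst S, ∃ a : (canonicalStructure.{u, v, w} hT).D,
      (eqn (hT.name (Sum.inr a)) c : Formula S.henkin) ∈ T := fun c =>
    ⟨⟨Quotient.mk _ c⟩, Quotient.mk_out (s := hT.setoid) c⟩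
  have sent : ∀ {A : Formula (S.diagram (canonicalStructure.{u, v, w} hT).D)}, A.IsSentence →
      (hT.translate A).IsSentence := fun h =>
    IsSentence.map (S := S.diagram (canonicalStructure.{u, v, w} hT).D) h _
  have tsubst : ∀ (x : ℕ) (a : (canonicalStructure.{u, v, w} hT).D)
      (A : Formula (S.diagram (canonicalStructure.{u, v, w} hT).D)),
      hT.translate (A.subst x (Sum.inr a)) = (hT.translate A).subst x (hT.name (Sum.inr a)) :=
    fun x a A => map_subst (S := S.diagram (canonicalStructure.{u, v, w} hT).D) _ x _ A
  have tneg : ∀ A : Formula (S.diagram (canonicalStructure.{u, v, w} hT).D),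
      hT.translate A.neg = (hT.translate A).neg := fun _ => rfl
  constructor
  · intro n P c
    rw [decide_eq_true_eq]
    exact ⟨hT.congr_pred (fun i => hT.eqn_name (c i)) id fun _ _ _ => rfl,
      hT.congr_pred (fun i => symm (hT.eqn_name (c i))) id fun _ _ _ => rfl⟩
  · intro n P c
    rw [decide_eq_true_eq]
    exact ⟨hT.congr_pred (fun i => hT.eqn_name (c i)) .neg fun _ _ _ => rfl,
      hT.congr_pred (fun i => symm (hT.eqn_name (c i))) .neg fun _ _ _ => rfl⟩
  · intro A B h
    simp only [decide_eq_true_eq]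
    exact hT.and_mem
  · intro A B h
    simp only [decide_eq_true_eq]
    exact hT.or_mem (sent h)
  · intro A B h
    simp only [decide_eq_true_eq]
    exact hT.neg_and_mem (sent h)
  · intro A B h
    simp only [decide_eq_true_eq]
    exact hT.neg_or_mem
  · intro A h
    simp only [decide_eq_true_eq]
    exact hT.neg_neg_mem
  · intro x A h
    have hs := sent h
    simp only [decide_eq_true_eq, tsubst]
    refine ⟨fun hA a => hT.closed (.allE _ (hT.prov hA)), fun hA => hw _ hs ?_⟩
    obtain ⟨a, ha⟩ := rep (hT.translate (A.all x)).code
    exact hT.eqE ha (hA a)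
  · intro x A h
    have hs := sent h
    simp only [decide_eq_true_eq, tsubst]
    refine ⟨fun hA => ?_, fun ⟨a, ha⟩ => hT.closed (.exI hs (hT.prov ha))⟩
    obtain ⟨a, ha⟩ := rep (hT.translate (A.ex x)).code
    exact ⟨a, hT.eqE (symm ha) (hw _ hs hA)⟩
  · intro x A h
    have hs := sent h
    simp only [decide_eq_true_eq, tneg, tsubst]
    refine ⟨fun hA => ?_, fun ⟨a, ha⟩ => hT.closed (.negAllI hs (hT.prov ha))⟩
    obtain ⟨a, ha⟩ := rep (hT.translate (A.all x).neg).code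
    exact ⟨a, hT.eqE (A := .neg (hT.translate A)) (symm ha)
      (hw (.neg (.all x (hT.translate A))) hs hA)⟩
  · intro x A h
    have hs := sent h
    simp only [decide_eq_true_eq, tneg, tsubst]
    refine ⟨fun hA a => hT.closed (.negExE _ (hT.prov hA)),
      fun hA => hw (.neg (.ex x (hT.translate A))) hs ?_⟩
    obtain ⟨a, ha⟩ := rep (hT.translate (A.ex x).neg).code
    exact hT.eqE (A := .neg (hT.translate A)) ha (hA a)

theorem map_toDiagram {D : Type*} {C : Type*} [Infinite C] (g : S.Const ⊕ D → C)
    (A : Formula S) :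
    (map (S := S.diagram D) g (A.toDiagram D) : Formula (S.withConst C)) = A.map fun c => g (Sum.inl c) := by
  induction A with
  | pred P ts =>
    simp only [toDiagram, map]
    congr 1
    funext i
    cases ts i <;> rfl
  | neg A ih => simp only [toDiagram, map, ih]
  | and A B ihA ihB => simp only [toDiagram, map, ihA, ihB]
  | or A B ihA ihB => simp only [toDiagram, map, ihA, ihB]
  | all z A ih => simp only [toDiagram, map, ih]
  | ex z A ih => simp only [toDiagram, map, ih]

theorem IsPrimeTheory.canonicalStructure_holds (hT : IsPrimeTheory L T)
    (hw : ∀ F : Formula S.henkin, F.IsSentence → Witnesses T F.code F) (A : Sentence S) :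
    (canonicalStructure.{u, v, w} hT).Holds A ↔ A.val.map HenkinConst.base ∈ T := by
  classical
  have h := (canonicalStructure.{u, v, w} hT).existsUnique_inducedValuation.unique
    (canonicalStructure.{u, v, w} hT).valuation_isInduced (hT.isInducedValuation hw)
  rw [Structure.Holds, h, decide_eq_true_eq]
  exact iff_of_eq (congrArg (· ∈ T) (map_toDiagram (hT.name (S := S)) A.val))

theorem IsPrimeTheory.isStructure (hT : IsPrimeTheory L T) {D : Formula S.henkin}
    (hD : D.IsSentence) (hDT : D ∉ T) :
    L.IsStructure (canonicalStructure.{u, v, w} hT) := by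
  have sent : ∀ {n : ℕ} (P : S.Pred n) (c : Fin n → HenkinConst S),
      (.pred P fun i => .const (c i) : Formula S.henkin).IsSentence :=
    fun P c => .pred_const (S := S.henkin) P c
  have exhaustive : L.HasPEM → (canonicalStructure.{u, v, w} hT).IsExhaustive := fun hL n P =>
    Set.eq_univ_of_forall fun a => hT.prime (hT.closed (.pem hL (sent P _)))
  have exclusive : L.HasEXP → (canonicalStructure.{u, v, w} hT).IsExclusive := fun hL n P =>
    Set.eq_empty_of_forall_notMem fun a ha =>
      hDT (hT.closed (.exp hL hD (hT.prov ha.1) (hT.prov ha.2)))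
  cases L
  exacts [exhaustive trivial, exclusive trivial, ⟨exhaustive trivial, exclusive trivial⟩]

end

theorem Consequence.provable {Γ : Set (Sentence S)} {A : Sentence S}
    (h : Consequence.{u, v, max u v w} L Γ A) : Provable L Γ A := by
  have := S.infinite_const
  by_contra hn
  have base_mem : ∀ B : Formula S, ConstsIn (Set.range HenkinConst.base)
      (B.map (HenkinConst.base (S := S))) := fun B c hc =>
    let ⟨d, hd, _⟩ := hc.of_map
    ⟨d, hd⟩
  have hsep : Separable L (Set.range HenkinConst.base)
      (map HenkinConst.base '' (Subtype.val '' Γ)) (A.val.map HenkinConst.base) := by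
    refine ⟨?_, A.2.map _, ?_, base_mem _, ?_⟩
    · rintro _ ⟨_, ⟨B, -, rfl⟩, rfl⟩
      exact B.2.map _
    · rintro _ ⟨B, -, rfl⟩
      exact base_mem B
    · -- a derivation in the Henkin language can be renamed into one in the language of `S`
      rintro ⟨Γ₀, hΓ₀, d⟩
      have inv := Function.leftInverse_invFun (f := HenkinConst.base (S := S))
        fun _ _ => HenkinConst.base.inj
      have d' := d.prov_map (Function.invFun (HenkinConst.base (S := S)))
      rw [map_map_leftInverse inv] at d'
      obtain ⟨Γ₁, hΓ₁, d₁⟩ := d'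
      refine hn ⟨Γ₁, hΓ₁.trans ?_, d₁⟩
      rintro _ ⟨_, hB, rfl⟩
      obtain ⟨B, hBΓ, rfl⟩ := hΓ₀ hB
      rw [map_map_leftInverse inv]
      exact hBΓ
  obtain ⟨T, hT, hΓT, hAT, hw⟩ := hsep.exists_henkinTheory
  refine hAT ((IsPrimeTheory.canonicalStructure_holds.{u, v, w} hT hw A).1
    (h _ (hT.isStructure (A.2.map _) hAT) fun B hB => ?_))
  exact (IsPrimeTheory.canonicalStructure_holds.{u, v, w} hT hw B).2
    (hΓT ⟨_, ⟨B, hB, rfl⟩, rfl⟩)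

end Canonical

end QFDE

theorem mainTheorem6 (L : QFDE.ExtLogic) (S : QFDE.Signature.{u, v})
    (Γ : Set (QFDE.Sentence S)) (A : QFDE.Sentence S) :
    QFDE.Provable L Γ A ↔ QFDE.Consequence.{u, v, max u v w} L Γ A :=
  ⟨QFDE.Provable.consequence, QFDE.Consequence.provable⟩
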